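/- **Conventions.** An exact category is an additive category with an exact structure in the sense of Quillen, given by its conflations $X\rightarrowtail Y\twoheadrightarrow Z$; $\mathrm{Ext}^1(A,C)$ is the set of equivalence classes of conflations $C\rightarrowtail B\twoheadrightarrow A$, and $\mathrm{Ext}^1(A,C)_B$ is the subset of classes whose middle term is isomorphic to $B$. An object $P$ is projective if $\mathrm{Ext}^1(P,X)=0$ for all $X$, and injective if $\mathrm{Ext}^1(X,P)=0$ for all $X$. A Frobenius category is an exact category with enough projectives and enough injectives in which the projective and the injective objects coincide; for a Frobenius category $\mathcal F$, let $\mathcal P(\mathcal F)$ be its full subcategory of projective-injective objects. The stable category $\underline{\mathcal F}$ has the same objects as $\mathcal F$, and its morphisms are those of $\mathcal F$ modulo the morphisms that factor through an object of $\mathcal P(\mathcal F)$. $K_0(\mathcal P(\mathcal F))$ is the abelian group generated by symbols $[P]$, $P\in\mathcal P(\mathcal F)$, with a relation $[Y]=[X]+[Z]$ for each conflation $X\rightarrowtail Y\twoheadrightarrow Z$ of $\mathcal F$ with terms in $\mathcal P(\mathcal F)$. Consider the conditions * (C1) $\mathcal F$ is essentially small, idempotent complete, and linear over some field; * (C2)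 $\mathrm{Hom}_{\mathcal F}(A,B)$ is a finite set for all $A,B\in\mathcal F$. If $\mathcal F$ is a Frobenius category satisfying (C1) and (C2), then its Hall algebra $\mathcal H(\mathcal F)$ is the associative unital $\mathbb Q$-algebra with basis the isomorphism classes $[A]$ of objects of $\mathcal F$, unit $[0]$, and product $$[A]\diamond[C]=\sum_{[B]}\frac{|\mathrm{Ext}^1(A,C)_B|}{|\mathrm{Hom}(A,C)|}\,[B].$$ The classes $[P]$, $P\in\mathcal P(\mathcal F)$, generate a multiplicative set satisfying the Ore conditions, and the semi-derived Hall algebra is the localization $$\mathcal{SDH}(\mathcal F,\mathcal P(\mathcal F))=\mathcal H(\mathcal F)\bigl[[P]^{-1}\mid P\in\mathcal P(\mathcal F)\bigr].$$ **Theorem.** Let $\mathcal F',\mathcal F$ be Frobenius categories satisfying (C1) and (C2). Let $F:\mathcal F'\to\mathcal F$ be a fully faithful exact functor (that is, additive and sending conflations to conflations) which sends projective-injective objects to projective-injective objects. Assume that the induced functor $\underline{\mathcal F'}\to\underline{\mathcal F}$ is an equivalence of categories, and that the induced homomorphism $K_0(\mathcal P(\mathcal F'))\to K_0(\mathcal P(\mathcal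 F))$, $[P]\mapsto[F(P)]$, is an isomorphism. Then $F$ induces an isomorphism of algebras: there is a unique isomorphism of $\mathbb Q$-algebras $$F_*:\mathcal{SDH}(\mathcal F',\mathcal P(\mathcal F'))\xrightarrow{\ \sim\ }\mathcal{SDH}(\mathcal F,\mathcal P(\mathcal F))$$ which sends the class $[M]$ to $[F(M)]$ for every object $M$ of $\mathcal F'$. -/

import Mathlib

open CategoryTheory CategoryTheory.Limits
open scoped ZeroObject

universe w' w v u

namespace SemiDerivedHall

/-- An exact category in the sense of Quillen: an additive category with a class of
kernel-cokernel pairs `X ⟶ Y ⟶ Z`, the conflations, closed under isomorphism and such that the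
inflations (first maps of conflations) and the deflations (second maps) contain the identities, are
closed under composition, and are stable under pushouts, respectively pullbacks, along arbitrary
morphisms. -/
class ExactCategory (E : Type u) [Category.{v} E] [Preadditive E] [HasZeroObject E]
    [HasBinaryBiproducts E] where
  /-- `Conflation i p` says that `(i, p)` is a conflation. -/
  Conflation : ∀ {X Y Z : E}, (X ⟶ Y) → (Y ⟶ Z) → Prop
  zero : ∀ {X Y Z : E} {i : X ⟶ Y} {p : Y ⟶ Z}, Conflation i p → i ≫ p = 0
  isKernel : ∀ {X Y Z : E} {i : X ⟶ Y} {p : Y ⟶ Z} (h : Conflation i p),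
    Nonempty (IsLimit (KernelFork.ofι i (zero h)))
  isCokernel : ∀ {X Y Z : E} {i : X ⟶ Y} {p : Y ⟶ Z} (h : Conflation i p),
    Nonempty (IsColimit (CokernelCofork.ofπ p (zero h)))
  of_iso : ∀ {X Y Z X' Y' Z' : E} {i : X ⟶ Y} {p : Y ⟶ Z} {i' : X' ⟶ Y'} {p' : Y' ⟶ Z'}
    (a : X ≅ X') (b : Y ≅ Y') (c : Z ≅ Z'), i ≫ b.hom = a.hom ≫ i' → p ≫ c.hom = b.hom ≫ p' →
    Conflation i p → Conflation i' p'
  id_inflation : ∀ X : E, ∃ (Z : E) (p : X ⟶ Z), Conflation (𝟙 X) p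
  id_deflation : ∀ X : E, ∃ (K : E) (i : K ⟶ X), Conflation i (𝟙 X)
  comp_inflation : ∀ {X Y W : E} (f : X ⟶ Y) (g : Y ⟶ W),
    (∃ (Z : E) (p : Y ⟶ Z), Conflation f p) → (∃ (Z : E) (p : W ⟶ Z), Conflation g p) →
    ∃ (Z : E) (p : W ⟶ Z), Conflation (f ≫ g) p
  comp_deflation : ∀ {X Y W : E} (f : X ⟶ Y) (g : Y ⟶ W),
    (∃ (K : E) (i : K ⟶ X), Conflation i f) → (∃ (K : E) (i : K ⟶ Y), Conflation i g) →
    ∃ (K : E) (i : K ⟶ X), Conflation i (f ≫ g)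
  pushout_inflation : ∀ {X Y X' : E} (i : X ⟶ Y) (f : X ⟶ X'),
    (∃ (Z : E) (p : Y ⟶ Z), Conflation i p) →
    ∃ (Y' : E) (i' : X' ⟶ Y') (g : Y ⟶ Y'), IsPushout i f g i' ∧
      ∃ (Z : E) (p : Y' ⟶ Z), Conflation i' p
  pullback_deflation : ∀ {Y Z Z' : E} (p : Y ⟶ Z) (f : Z' ⟶ Z),
    (∃ (K : E) (i : K ⟶ Y), Conflation i p) →
    ∃ (Y' : E) (g : Y' ⟶ Y) (p' : Y' ⟶ Z'), IsPullback g p' p f ∧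
      ∃ (K : E) (i : K ⟶ Y'), Conflation i p'

section Exact

variable {E : Type u} [Category.{v} E] [Preadditive E] [HasZeroObject E] [HasBinaryBiproducts E]
  [ExactCategory E]

/-- `(i, p)` is a conflation `X ↣ Y ↠ Z` of the exact category `E`. -/
def IsConflation {X Y Z : E} (i : X ⟶ Y) (p : Y ⟶ Z) : Prop := ExactCategory.Conflation i p

namespace IsConflation

variable {X Y Z : E} {i : X ⟶ Y} {p : Y ⟶ Z}

theorem w (h : IsConflation i p) : i ≫ p = 0 := ExactCategory.zero h

theorem mono (h : IsConflation i p) : Mono i :=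
  (ExactCategory.isKernel h).elim fun t => mono_of_isLimit_fork t

theorem epi (h : IsConflation i p) : Epi p :=
  (ExactCategory.isCokernel h).elim fun t => epi_of_isColimit_cofork t

theorem lift (h : IsConflation i p) {T : E} (t : T ⟶ Y) (ht : t ≫ p = 0) : ∃ u, u ≫ i = t :=
  (ExactCategory.isKernel h).elim fun l => ⟨_, (KernelFork.IsLimit.lift' l t ht).2⟩

theorem desc (h : IsConflation i p) {T : E} (t : Y ⟶ T) (ht : i ≫ t = 0) : ∃ u, p ≫ u = t :=
  (ExactCategory.isCokernel h).elim fun l => ⟨_, (CokernelCofork.IsColimit.desc' l t ht).2⟩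

theorem lift_hom (h : IsConflation i p) {T : E} {f g : T ⟶ X} (e : f ≫ i = g ≫ i) : f = g :=
  have := h.mono; (cancel_mono i).1 e

theorem desc_hom (h : IsConflation i p) {T : E} {f g : Z ⟶ T} (e : p ≫ f = p ≫ g) : f = g :=
  have := h.epi; (cancel_epi p).1 e

theorem mid (h : IsConflation i p) {Y' : E} (e : Y ≅ Y') :
    IsConflation (i ≫ e.hom) (e.inv ≫ p) :=
  ExactCategory.of_iso (Iso.refl _) e (Iso.refl _) (by simp) (by simp) h

/-- Any kernel of a deflation gives a conflation. -/
theorem of_kernel (h : IsConflation i p) {X' : E} (i' : X' ⟶ Y) (w : i' ≫ p = 0)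
    (hl : ∀ {T : E} (t : T ⟶ Y), t ≫ p = 0 → ∃ u, u ≫ i' = t)
    (hm : ∀ {T : E} (f g : T ⟶ X'), f ≫ i' = g ≫ i' → f = g) : IsConflation i' p := by
  obtain ⟨a, ha⟩ := h.lift i' w
  obtain ⟨b, hb⟩ := hl i h.w
  refine ExactCategory.of_iso (⟨b, a, h.lift_hom (by simp [ha, hb]), hm _ _ (by simp [ha, hb])⟩)
    (Iso.refl _) (Iso.refl _) ?_ (by simp) h
  simp [hb]

/-- Any cokernel of an inflation gives a conflation. -/
theorem of_cokernel (h : IsConflation i p) {Z' : E} (p' : Y ⟶ Z') (w : i ≫ p' = 0)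
    (hl : ∀ {T : E} (t : Y ⟶ T), i ≫ t = 0 → ∃ u, p' ≫ u = t)
    (hm : ∀ {T : E} (f g : Z' ⟶ T), p' ≫ f = p' ≫ g → f = g) : IsConflation i p' := by
  obtain ⟨a, ha⟩ := h.desc p' w
  obtain ⟨b, hb⟩ := hl p h.w
  refine ExactCategory.of_iso (Iso.refl _) (Iso.refl _)
    (⟨a, b, h.desc_hom (by rw [reassoc_of% ha, hb, Category.comp_id]),
      hm _ _ (by rw [reassoc_of% hb, ha, Category.comp_id])⟩) (by simp) ?_ h
  simp [ha]

/-- Two conflations with the same deflation have isomorphic kernels. -/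
theorem kernelIso (h : IsConflation i p) {X' : E} {i' : X' ⟶ Y} (h' : IsConflation i' p) :
    ∃ e : X ≅ X', e.hom ≫ i' = i := by
  obtain ⟨a, ha⟩ := h.lift i' h'.w
  obtain ⟨b, hb⟩ := h'.lift i h.w
  exact ⟨⟨b, a, h.lift_hom (by simp [ha, hb]), h'.lift_hom (by simp [ha, hb])⟩, hb⟩

/-- Two conflations with the same inflation have isomorphic cokernels. -/
theorem cokernelIso (h : IsConflation i p) {Z' : E} {p' : Y ⟶ Z'} (h' : IsConflation i p') :
    ∃ e : Z ≅ Z', p ≫ e.hom = p' := by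
  obtain ⟨a, ha⟩ := h.desc p' h'.w
  obtain ⟨b, hb⟩ := h'.desc p h.w
  exact ⟨⟨a, b, h.desc_hom (by rw [reassoc_of% ha, hb, Category.comp_id]),
    h'.desc_hom (by rw [reassoc_of% hb, ha, Category.comp_id])⟩, ha⟩

theorem src (h : IsConflation i p) {X' : E} (e : X' ≅ X) : IsConflation (e.hom ≫ i) p :=
  ExactCategory.of_iso e.symm (Iso.refl _) (Iso.refl _) (by simp) (by simp) h

theorem tgt (h : IsConflation i p) {Z' : E} (e : Z ≅ Z') : IsConflation i (p ≫ e.hom) :=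
  ExactCategory.of_iso (Iso.refl _) (Iso.refl _) e (by simp) (by simp) h

/-- The five lemma, for conflations with the same end terms. -/
theorem isIso_of_hom (h : IsConflation i p) {Y' : E} {i' : X ⟶ Y'} {p' : Y' ⟶ Z}
    (h' : IsConflation i' p') (f : Y ⟶ Y') (hi : i ≫ f = i') (hp : f ≫ p' = p) : IsIso f := by
  obtain ⟨D, q, q', sq, K, j₀, hj₀⟩ := ExactCategory.pullback_deflation p p' ⟨_, i, h⟩
  replace hj₀ : IsConflation j₀ q' := hj₀
  -- `D = Y ×_Z Y'`, with `q'` a deflation with kernel `(i, 0)`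
  let j : X ⟶ D := sq.lift i 0 (by simp [h.w])
  have hjq : j ≫ q = i := sq.lift_fst _ _ _
  have hjq' : j ≫ q' = 0 := sq.lift_snd _ _ _
  have hj : IsConflation j q' := hj₀.of_kernel j hjq'
    (fun t ht => by
      obtain ⟨u, hu⟩ := h.lift (t ≫ q) (by rw [Category.assoc, sq.w, reassoc_of% ht, zero_comp])
      exact ⟨u, sq.hom_ext (by simp [hjq, hu]) (by simp [hjq', ht])⟩)
    (fun f g e => h.lift_hom (by
      have := congrArg (· ≫ q) e
      simpa [hjq] using this))
  obtain ⟨t, ht⟩ := h'.lift (q' - q ≫ f) (by simp [hp, sq.w])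
  have hjt : j ≫ t = -𝟙 X := h'.lift_hom (by
    simp [ht, hjq', reassoc_of% hjq, hi])
  obtain ⟨r, hr⟩ := hj.desc (q + t ≫ i) (by simp [hjq, reassoc_of% hjt])
  let s : Y ⟶ D := sq.lift (𝟙 Y) f (by simp [hp])
  have hsq : s ≫ q = 𝟙 Y := sq.lift_fst _ _ _
  have hsq' : s ≫ q' = f := sq.lift_snd _ _ _
  have hst : s ≫ t = 0 := h'.lift_hom (by simp [ht, hsq', reassoc_of% hsq])
  refine ⟨r, ?_, hj.desc_hom ?_⟩
  · rw [← hsq', Category.assoc, hr]; simp [hsq, reassoc_of% hst]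
  · rw [reassoc_of% hr]
    simp [hi, ht]

end IsConflation

/-- The split sequence is a conflation. -/
theorem isConflation_biprod (A C : E) :
    IsConflation (biprod.inr : C ⟶ A ⊞ C) (biprod.fst : A ⊞ C ⟶ A) := by
  obtain ⟨K, i, hi⟩ := ExactCategory.id_deflation A
  replace hi : IsConflation i (𝟙 A) := hi
  have hi0 : i = 0 := by simpa using hi.w
  obtain ⟨Y', i', g, sq, Z, p, hp⟩ := ExactCategory.pushout_inflation i (0 : K ⟶ C) ⟨_, _, hi⟩
  replace hp : IsConflation i' p := hp
  have w₁ : i ≫ (biprod.inl : A ⟶ A ⊞ C) = (0 : K ⟶ C) ≫ biprod.inr := by simp [hi0]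
  let e : Y' ≅ A ⊞ C := ⟨sq.desc biprod.inl biprod.inr w₁, biprod.desc g i',
    sq.hom_ext (by simp) (by simp), by ext <;> simp⟩
  have he : i' ≫ e.hom = biprod.inr := sq.inr_desc _ _ _
  have h1 := hp.mid e
  rw [he] at h1
  exact h1.of_cokernel _ (by simp)
    (fun t ht => ⟨biprod.inl ≫ t, by ext <;> simp [ht]⟩)
    (fun f g e => by simpa using congrArg (biprod.inl ≫ ·) e)

/-- The Noether isomorphism: given `C ↣ M ↠ X` and `B ↣ X ↠ A`, the kernel `Y` of the composite
`M ↠ A` is an extension of `B` by `C`. -/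
theorem noether_left {A B C M X Y : E} {j : B ⟶ X} {q : X ⟶ A} {i : C ⟶ M} {p : M ⟶ X}
    {y : Y ⟶ M} {a : C ⟶ Y} {b : Y ⟶ B} (h1 : IsConflation j q) (h2 : IsConflation i p)
    (h3 : IsConflation y (p ≫ q)) (ha : a ≫ y = i) (hb : b ≫ j = y ≫ p) : IsConflation a b := by
  obtain ⟨Y', g, b', sq, K, k, hk⟩ := ExactCategory.pullback_deflation p j ⟨_, _, h2⟩
  replace hk : IsConflation k b' := hk
  obtain ⟨e, he⟩ := h3.lift g (by rw [← Category.assoc, sq.w, Category.assoc, h1.w, comp_zero])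
  let e' : Y ⟶ Y' := sq.lift y b hb.symm
  have h4 : e' ≫ g = y := sq.lift_fst _ _ _
  have h5 : e' ≫ b' = b := sq.lift_snd _ _ _
  have hee : e' ≫ e = 𝟙 _ := h3.lift_hom (by simp [he, h4])
  have heb : e ≫ b = b' := h1.lift_hom (by rw [Category.assoc, hb, reassoc_of% he, sq.w])
  have hee' : e ≫ e' = 𝟙 _ := sq.hom_ext (by simp [he, h4]) (by simp [h5, heb])
  have h6 := hk.mid ⟨e, e', hee', hee⟩
  simp only [h5] at h6
  refine h6.of_kernel a (h1.lift_hom ?_) (fun t ht => ?_) (fun f g e => h2.lift_hom ?_)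
  · rw [Category.assoc, hb, reassoc_of% ha, h2.w, zero_comp]
  · obtain ⟨u, hu⟩ := h2.lift (t ≫ y) (by
      rw [Category.assoc, ← hb, reassoc_of% ht, zero_comp])
    exact ⟨u, h3.lift_hom (by rw [Category.assoc, ha, hu])⟩
  · rw [← ha, reassoc_of% e]

/-- The dual Noether isomorphism: given `Y ↣ M ↠ A` and `C ↣ Y ↠ B`, the cokernel `X` of the
composite `C ↣ M` is an extension of `A` by `B`. -/
theorem noether_right {A B C M X Y : E} {j : B ⟶ X} {q : X ⟶ A} {r : M ⟶ A} {p : M ⟶ X}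
    {y : Y ⟶ M} {a : C ⟶ Y} {b : Y ⟶ B} (h1 : IsConflation a b) (h2 : IsConflation y r)
    (h3 : IsConflation (a ≫ y) p) (hq : p ≫ q = r) (hj : b ≫ j = y ≫ p) : IsConflation j q := by
  obtain ⟨X', j', g, sq, K, k, hk⟩ := ExactCategory.pushout_inflation y b ⟨_, _, h2⟩
  replace hk : IsConflation j' k := hk
  obtain ⟨e, he⟩ := h3.desc g (by rw [Category.assoc, sq.w, ← Category.assoc, h1.w, zero_comp])
  let e' : X' ⟶ X := sq.desc p j hj.symm
  have h4 : g ≫ e' = p := sq.inl_desc _ _ _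
  have h5 : j' ≫ e' = j := sq.inr_desc _ _ _
  have hee : e ≫ e' = 𝟙 _ := h3.desc_hom (by rw [reassoc_of% he, h4, Category.comp_id])
  have heb : j ≫ e = j' := h1.desc_hom (by rw [reassoc_of% hj, he, sq.w])
  have hee' : e' ≫ e = 𝟙 _ := sq.hom_ext
    (by rw [reassoc_of% h4, he, Category.comp_id]) (by rw [reassoc_of% h5, heb, Category.comp_id])
  have h6 := hk.mid ⟨e', e, hee', hee⟩
  simp only [h5] at h6
  refine h6.of_cokernel q (h1.desc_hom ?_) (fun t ht => ?_) (fun f g e => h2.desc_hom ?_)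
  · rw [reassoc_of% hj, hq, h2.w, comp_zero]
  · obtain ⟨u, hu⟩ := h2.desc (p ≫ t) (by rw [← reassoc_of% hj, ht, comp_zero])
    exact ⟨u, h3.desc_hom (by rw [reassoc_of% hq, hu])⟩
  · rw [← hq, Category.assoc, Category.assoc, e]

end Exact

/-- The set of isomorphism classes of objects. -/
abbrev IsoClass (E : Type u) [Category.{v} E] : Type u := _root_.Quotient (isIsomorphicSetoid E)

/-- The isomorphism class of an object. -/
abbrev isoClass {E : Type u} [Category.{v} E] (X : E) : IsoClass E :=
  Quotient.mk (isIsomorphicSetoid E) X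

theorem isoClass_eq {E : Type u} [Category.{v} E] {X Y : E} :
    isoClass X = isoClass Y ↔ Nonempty (X ≅ Y) := Quotient.eq

/-- Finiteness of the morphism spaces. -/
class HomFinite (E : Type u) [Category.{v} E] : Prop where
  finite : ∀ A B : E, Finite (A ⟶ B)

instance {E : Type u} [Category.{v} E] [HomFinite E] (A B : E) : Finite (A ⟶ B) :=
  HomFinite.finite A B

theorem finite_iso {E : Type u} [Category.{v} E] [HomFinite E] (A B : E) : Finite (A ≅ B) :=
  Finite.of_injective (fun e : A ≅ B => e.hom) fun _ _ h => Iso.ext h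

section Ext

variable {E : Type u} [Category.{v} E] [Preadditive E] [HasZeroObject E] [HasBinaryBiproducts E]
  [ExactCategory E]

/-- An extension of `A` by `C`: a conflation `C ↣ mid ↠ A`. -/
structure Extension (A C : E) where
  mid : E
  ι : C ⟶ mid
  π : mid ⟶ A
  conf : IsConflation ι π

/-- Equivalence of extensions: an isomorphism of the middle terms inducing the identity on the end
terms. -/
instance extensionSetoid (A C : E) : Setoid (Extension A C) where
  r x y := ∃ e : x.mid ≅ y.mid, x.ι ≫ e.hom = y.ι ∧ e.hom ≫ y.π = x.π
  iseqv :=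
    { refl := fun x => ⟨Iso.refl _, by simp, by simp⟩
      symm := fun ⟨e, h1, h2⟩ => ⟨e.symm, by simp [← h1], by simp [← h2]⟩
      trans := fun ⟨e, h1, h2⟩ ⟨e', h1', h2'⟩ =>
        ⟨e ≪≫ e', by simp [reassoc_of% h1, h1'], by simp [h2, h2']⟩ }

/-- `Ext¹(A, C)`, the set of equivalence classes of extensions of `A` by `C`. It is never empty: its
zero element is the class of the split extension. -/
def Ext1 (A C : E) : Type (max u v) := _root_.Quotient (extensionSetoid A C)

/-- The isomorphism class of the middle term of an extension class. -/
def Ext1.middle {A C : E} : Ext1 A C → IsoClass E :=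
  Quotient.lift (fun x => isoClass x.mid) fun _ _ ⟨e, _⟩ => isoClass_eq.2 ⟨e⟩

/-- The subset `Ext¹(A, C)_B` of the extension classes with middle term isomorphic to `B`. -/
abbrev Ext1Mid (A C : E) (b : IsoClass E) : Type (max u v) := {ξ : Ext1 A C // ξ.middle = b}

/-- An object `P` is projective if `Ext¹(P, X) = 0` for all `X`. -/
def IsProjective (P : E) : Prop := ∀ X : E, Subsingleton (Ext1 P X)

/-- An object `I` is injective if `Ext¹(X, I) = 0` for all `X`. -/
def IsInjective (I : E) : Prop := ∀ X : E, Subsingleton (Ext1 X I)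

variable (E) in
/-- A Frobenius category: an exact category with enough projectives and enough injectives, in which
the projective objects and the injective objects coincide. -/
class IsFrobenius : Prop where
  enough_projectives : ∀ X : E, ∃ (K P : E) (i : K ⟶ P) (p : P ⟶ X),
    IsConflation i p ∧ IsProjective P
  enough_injectives : ∀ X : E, ∃ (I Z : E) (i : X ⟶ I) (p : I ⟶ Z),
    IsConflation i p ∧ IsInjective I
  projective_iff_injective : ∀ X : E, IsProjective X ↔ IsInjective X

variable (E) in
/-- Finiteness of the first extension spaces. -/
class ExtFinite : Prop where
  finite : ∀ A C : E, Finite (Ext1 A C)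

instance [ExtFinite E] (A C : E) : Finite (Ext1 A C) := ExtFinite.finite A C

/-- The class of the split extension. -/
noncomputable def splitExt (A C : E) : Ext1 A C :=
  ⟦⟨A ⊞ C, biprod.inr, biprod.fst, isConflation_biprod A C⟩⟧

theorem IsConflation.exists_section {C Y A : E} {i : C ⟶ Y} {p : Y ⟶ A} (h : IsConflation i p)
    (hs : Subsingleton (Ext1 A C)) : ∃ s : A ⟶ Y, s ≫ p = 𝟙 A := by
  obtain ⟨e, -, h2⟩ := Quotient.exact
    (hs.elim ⟦⟨A ⊞ C, biprod.inr, biprod.fst, isConflation_biprod A C⟩⟧ ⟦⟨Y, i, p, h⟩⟧)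
  exact ⟨biprod.inl ≫ e.hom, by rw [Category.assoc, h2]; simp⟩

theorem subsingleton_ext1 {A C : E} (H : ∀ {Y : E} (i : C ⟶ Y) (p : Y ⟶ A), IsConflation i p →
    ∃ s : A ⟶ Y, s ≫ p = 𝟙 A) : Subsingleton (Ext1 A C) := by
  refine subsingleton_of_forall_eq (splitExt A C) fun ξ => ?_
  induction ξ using Quotient.inductionOn with | _ x => ?_
  obtain ⟨Y, i, p, h⟩ := x
  obtain ⟨s, hs⟩ := H i p h
  have := (isConflation_biprod A C).isIso_of_hom h (biprod.desc s i) (by simp)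
    (by ext <;> simp [hs, h.w])
  exact Quotient.sound (Setoid.symm ⟨asIso (biprod.desc s i), by simp, by
    ext <;> simp [hs, h.w]⟩)

/-- Morphisms from a projective object lift along deflations. -/
theorem IsProjective.exists_lift {P : E} (hP : IsProjective P) {K Y Z : E} {i : K ⟶ Y} {p : Y ⟶ Z}
    (h : IsConflation i p) (f : P ⟶ Z) : ∃ g : P ⟶ Y, g ≫ p = f := by
  obtain ⟨Y', g, p', sq, K', k, hk⟩ := ExactCategory.pullback_deflation p f ⟨_, _, h⟩
  replace hk : IsConflation k p' := hk
  obtain ⟨s, hs⟩ := hk.exists_section (hP _)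
  exact ⟨s ≫ g, by rw [Category.assoc, sq.w, reassoc_of% hs]⟩

theorem isProjective_of_lift {P : E} (H : ∀ {K Y : E} (i : K ⟶ Y) (p : Y ⟶ P), IsConflation i p →
    ∃ s : P ⟶ Y, s ≫ p = 𝟙 P) : IsProjective P := fun _ => subsingleton_ext1 H

theorem isProjective_biprod {P Q : E} (hP : IsProjective P) (hQ : IsProjective Q) :
    IsProjective (P ⊞ Q) := isProjective_of_lift fun i p h => by
  obtain ⟨s, hs⟩ := hP.exists_lift h biprod.inl
  obtain ⟨t, ht⟩ := hQ.exists_lift h biprod.inr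
  exact ⟨biprod.desc s t, by ext <;> simp [hs, ht]⟩

theorem isProjective_zero : IsProjective (0 : E) := isProjective_of_lift fun _ _ _ =>
  ⟨0, (isZero_zero E).eq_of_src _ _⟩

/-- Hom-finite Frobenius categories have finite extension spaces. -/
instance [IsFrobenius E] [HomFinite E] : ExtFinite E where
  finite A C := by
    obtain ⟨K, P, k, q, hk, hP⟩ := IsFrobenius.enough_projectives A
    have key : ∀ x : Extension A C, ∃ f : K ⟶ C, ∃ l : P ⟶ x.mid, l ≫ x.π = q ∧
        k ≫ l = f ≫ x.ι := fun x => by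
      obtain ⟨l, hl⟩ := hP.exists_lift x.conf q
      obtain ⟨f, hf⟩ := x.conf.lift (k ≫ l) (by rw [Category.assoc, hl, hk.w])
      exact ⟨f, l, hl, hf.symm⟩
    choose f l hl hf using key
    suffices inj : ∀ x y : Extension A C, f x = f y → x ≈ y from
      Finite.of_injective (fun ξ : Ext1 A C => f ξ.out) fun ξ η e => by
        rw [← Quotient.out_eq ξ, ← Quotient.out_eq η]
        exact Quotient.sound (inj _ _ e)
    intro x y e
    -- the pushout of `K ↣ P` along `f x = f y` is the middle term of both extensions
    obtain ⟨W, g, m, sq, Z, p, hp⟩ := ExactCategory.pushout_inflation k (f x) ⟨_, _, hk⟩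
    replace hp : IsConflation g p := hp
    let r : W ⟶ A := sq.desc q 0 (by rw [hk.w, comp_zero])
    have hmr : m ≫ r = q := sq.inl_desc _ _ _
    have hgr : g ≫ r = 0 := sq.inr_desc _ _ _
    have hr : IsConflation g r := hp.of_cokernel r hgr
      (fun t ht => by
        obtain ⟨u, hu⟩ := hk.desc (m ≫ t) (by rw [reassoc_of% sq.w, ht, comp_zero])
        exact ⟨u, sq.hom_ext (by rw [reassoc_of% hmr, hu])
          (by rw [reassoc_of% hgr, zero_comp, ht])⟩)
      (fun a b hab => hk.desc_hom (by rw [← hmr, Category.assoc, hab, Category.assoc]))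
    have main : ∀ z : Extension A C, f x = f z → (⟨W, g, r, hr⟩ : Extension A C) ≈ z := by
      intro z hz
      let u : W ⟶ z.mid := sq.desc (l z) z.ι (by rw [hf, hz])
      have h1 : g ≫ u = z.ι := sq.inr_desc _ _ _
      have h2 : u ≫ z.π = r := sq.hom_ext
        (by rw [sq.inl_desc_assoc, hl, hmr]) (by rw [sq.inr_desc_assoc, z.conf.w, hgr])
      have := hr.isIso_of_hom z.conf u h1 h2
      exact ⟨asIso u, h1, h2⟩
    exact Setoid.trans (Setoid.symm (main x rfl)) (main y e)

end Ext

set_option linter.unusedSectionVars false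

section Hall

variable {E : Type u} [Category.{v} E] [Preadditive E] [HasZeroObject E] [HasBinaryBiproducts E]
  [ExactCategory E]

/-- The structure constant `|Ext¹(A, C)_B| / |Hom(A, C)|` of the Hall algebra. -/
noncomputable def structureConst (A C : E) (b : IsoClass E) : ℚ :=
  (Nat.card (Ext1Mid A C b) : ℚ) / (Nat.card (A ⟶ C) : ℚ)

/-- The conflations `C ↣ M ↠ A` with fixed terms. -/
abbrev Conf (A C M : E) : Type v := {t : (C ⟶ M) × (M ⟶ A) // IsConflation t.1 t.2}

section

variable [HomFinite E]

instance (A C M : E) : Finite (Conf A C M) := inferInstance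

theorem card_conf_mul (A C M : E) : Nat.card (Conf A C M) * Nat.card (A ⟶ C) =
    Nat.card (Ext1Mid A C (isoClass M)) * Nat.card (M ≅ M) := by
  let cls : Conf A C M → Ext1Mid A C (isoClass M) := fun t => ⟨⟦⟨M, t.1.1, t.1.2, t.2⟩⟧, rfl⟩
  have hcls : Function.Surjective cls := by
    rintro ⟨ξ, hξ⟩
    induction ξ using Quotient.inductionOn with | _ x => ?_
    obtain ⟨e⟩ := isoClass_eq.1 hξ
    exact ⟨⟨(x.ι ≫ e.hom, e.inv ≫ x.π), x.conf.mid e⟩,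
      Subtype.ext (Quotient.sound ⟨e.symm, by simp, by simp⟩)⟩
  choose s hs using hcls
  have hβ : ∀ t : Conf A C M, ∃ e : M ≅ M, (s (cls t)).1.1 ≫ e.hom = t.1.1 ∧
      e.hom ≫ t.1.2 = (s (cls t)).1.2 := fun t =>
    Quotient.exact (congrArg Subtype.val (hs (cls t)))
  choose β hβ1 hβ2 using hβ
  have nil : ∀ (t : Conf A C M) (h h' : A ⟶ C), (t.1.2 ≫ h ≫ t.1.1) ≫ (t.1.2 ≫ h' ≫ t.1.1) = 0 :=
    fun t h h' => by simp [reassoc_of% t.2.w]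
  have hun : ∀ (t : Conf A C M) (h : A ⟶ C), ∃ e : M ≅ M, e.hom = 𝟙 M + t.1.2 ≫ h ≫ t.1.1 :=
    fun t h => ⟨
    { hom := 𝟙 M + t.1.2 ≫ h ≫ t.1.1
      inv := 𝟙 M - t.1.2 ≫ h ≫ t.1.1
      hom_inv_id := by rw [Preadditive.add_comp, Preadditive.comp_sub, Preadditive.comp_sub, nil]
                       simp
      inv_hom_id := by rw [Preadditive.sub_comp, Preadditive.comp_add, Preadditive.comp_add, nil]
                       simp }, rfl⟩
  choose un hun using hun
  have un1 : ∀ t h, t.1.1 ≫ (un t h).hom = t.1.1 := fun t h => by simp [hun, reassoc_of% t.2.w]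
  have un2 : ∀ t h, (un t h).hom ≫ t.1.2 = t.1.2 := fun t h => by simp [hun, t.2.w]
  rw [← Nat.card_prod, ← Nat.card_prod]
  refine Nat.card_congr (Equiv.ofBijective
    (fun z : Conf A C M × (A ⟶ C) => (cls z.1, β z.1 ≪≫ un z.1 z.2)) ⟨?_, ?_⟩)
  · rintro ⟨t, h⟩ ⟨t', h'⟩ e
    obtain ⟨e1, e2⟩ := Prod.mk.inj e
    have e3 : (β t).hom ≫ (un t h).hom = (β t').hom ≫ (un t' h').hom := congrArg Iso.hom e2
    have hι : t.1.1 = t'.1.1 := by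
      rw [← un1 t h, ← hβ1 t, Category.assoc, e3, e1, reassoc_of% hβ1 t', un1]
    have hπ : t.1.2 = t'.1.2 := by
      have : (β t).hom ≫ (un t h).hom ≫ t.1.2 = (β t).hom ≫ (un t h).hom ≫ t'.1.2 := by
        rw [un2, hβ2, reassoc_of% e3, un2, hβ2, e1]
      exact (cancel_epi (un t h).hom).1 ((cancel_epi (β t).hom).1 this)
    have ht : t = t' := Subtype.ext (Prod.ext hι hπ)
    subst ht
    have e4 := (cancel_epi (β t).hom).1 e3
    rw [hun, hun] at e4
    exact Prod.ext rfl (t.2.lift_hom (t.2.desc_hom (add_left_cancel e4)))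
  · rintro ⟨ξ, α⟩
    let t : Conf A C M := ⟨((s ξ).1.1 ≫ α.hom, α.inv ≫ (s ξ).1.2), (s ξ).2.mid α⟩
    have hc : cls t = ξ := by
      rw [← hs ξ]
      exact Subtype.ext (Quotient.sound ⟨α.symm, by simp [t], by simp [t]⟩)
    have h1 : t.1.1 ≫ (β t).inv ≫ α.hom = t.1.1 := by
      have := hβ1 t
      rw [hc] at this
      calc t.1.1 ≫ (β t).inv ≫ α.hom = (s ξ).1.1 ≫ (β t).hom ≫ (β t).inv ≫ α.hom := by
            rw [← this, Category.assoc]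
        _ = t.1.1 := by simp [t]
    have h2 : ((β t).inv ≫ α.hom) ≫ t.1.2 = t.1.2 := by
      have := hβ2 t
      rw [hc] at this
      rw [Category.assoc, Iso.inv_comp_eq, this]
      simp [t]
    obtain ⟨g, hg⟩ := t.2.lift ((β t).inv ≫ α.hom - 𝟙 M) (by simpa [sub_eq_zero] using h2)
    obtain ⟨h, hh⟩ := t.2.desc g (t.2.lift_hom (by
      rw [Category.assoc, hg, Preadditive.comp_sub, h1]; simp))
    refine ⟨(t, h), Prod.ext hc (Iso.ext ?_)⟩
    simp only [Iso.trans_hom, hun]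
    rw [reassoc_of% hh, hg]
    simp

theorem card_iso_ne_zero (M : E) : (Nat.card (M ≅ M) : ℚ) ≠ 0 := by
  have := finite_iso M M
  have : Nonempty (M ≅ M) := ⟨Iso.refl M⟩
  exact Nat.cast_ne_zero.2 Nat.card_pos.ne'

theorem card_hom_ne_zero (A B : E) : (Nat.card (A ⟶ B) : ℚ) ≠ 0 := by
  have : Nonempty (A ⟶ B) := ⟨0⟩
  exact Nat.cast_ne_zero.2 Nat.card_pos.ne'

theorem structureConst_eq (A C M : E) :
    structureConst A C (isoClass M) = (Nat.card (Conf A C M) : ℚ) / Nat.card (M ≅ M) := by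
  rw [structureConst, div_eq_div_iff (card_hom_ne_zero A C) (card_iso_ne_zero M)]
  exact_mod_cast (card_conf_mul A C M).symm

theorem structureConst_congr {A A' C C' : E} (a : A ≅ A') (c : C ≅ C') :
    structureConst A C = structureConst A' C' := by
  funext b
  induction b using Quotient.inductionOn with | _ M => ?_
  rw [structureConst_eq, structureConst_eq]
  congr 2
  exact Nat.card_congr
    { toFun := fun t => ⟨(c.inv ≫ t.1.1, t.1.2 ≫ a.hom), (t.2.src c.symm).tgt a⟩
      invFun := fun t => ⟨(c.hom ≫ t.1.1, t.1.2 ≫ a.inv), (t.2.src c).tgt a.symm⟩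
      left_inv := fun t => by simp
      right_inv := fun t => by simp }

theorem structureConst_ne_zero_iff (A C M : E) :
    structureConst A C (isoClass M) ≠ 0 ↔ Nonempty (Conf A C M) := by
  rw [structureConst_eq, Ne, div_eq_zero_iff, not_or, Nat.cast_eq_zero, ← Ne,
    Nat.card_ne_zero]
  exact ⟨fun h => h.1.1, fun h => ⟨⟨h, inferInstance⟩, card_iso_ne_zero M⟩⟩

open scoped Classical in
theorem card_kernels {Y₀ M A : E} {y₀ : Y₀ ⟶ M} {r : M ⟶ A} (h : IsConflation y₀ r) (Y : E) :
    (Nat.card {y : Y ⟶ M // IsConflation y r} : ℚ) / Nat.card (Y ≅ Y) =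
      if isoClass Y = isoClass Y₀ then 1 else 0 := by
  split_ifs with hY
  · obtain ⟨e⟩ := isoClass_eq.1 hY
    have h' := h.src e
    rw [div_eq_one_iff_eq (card_iso_ne_zero Y), Nat.cast_inj]
    refine (Nat.card_congr (Equiv.ofBijective
      (fun α : Y ≅ Y => ⟨α.hom ≫ e.hom ≫ y₀, h'.src α⟩) ⟨fun α β hab => ?_, fun y => ?_⟩)).symm
    · exact Iso.ext (h'.lift_hom (congrArg Subtype.val hab))
    · obtain ⟨f, hf⟩ := y.2.kernelIso h'
      exact ⟨f, Subtype.ext hf⟩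
  · have : IsEmpty {y : Y ⟶ M // IsConflation y r} :=
      ⟨fun y => hY (isoClass_eq.2 ⟨(y.2.kernelIso h).choose⟩)⟩
    simp

open scoped Classical in
theorem card_cokernels {C M X₀ : E} {i : C ⟶ M} {p₀ : M ⟶ X₀} (h : IsConflation i p₀) (X : E) :
    (Nat.card {p : M ⟶ X // IsConflation i p} : ℚ) / Nat.card (X ≅ X) =
      if isoClass X = isoClass X₀ then 1 else 0 := by
  split_ifs with hX
  · obtain ⟨e⟩ := isoClass_eq.1 hX.symm
    have h' := h.tgt e
    rw [div_eq_one_iff_eq (card_iso_ne_zero X), Nat.cast_inj]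
    refine (Nat.card_congr (Equiv.ofBijective
      (fun α : X ≅ X => ⟨(p₀ ≫ e.hom) ≫ α.hom, h'.tgt α⟩) ⟨fun α β hab => ?_, fun p => ?_⟩)).symm
    · exact Iso.ext (h'.desc_hom (congrArg Subtype.val hab))
    · obtain ⟨f, hf⟩ := h'.cokernelIso p.2
      exact ⟨f, Subtype.ext hf⟩
  · have : IsEmpty {p : M ⟶ X // IsConflation i p} :=
      ⟨fun p => hX (isoClass_eq.2 ⟨(p.2.cokernelIso h).choose⟩)⟩
    simp

/-- Filtrations `C ⊆ Y ⊆ M` with `M / C = X`, first form. -/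
abbrev FiltL (A B C M X Y : E) : Type v :=
  {z : (Conf A B X × Conf X C M) × (Y ⟶ M) // IsConflation z.2 (z.1.2.1.2 ≫ z.1.1.1.2)}

/-- Filtrations `C ⊆ Y ⊆ M` with `M / C = X`, second form. -/
abbrev FiltR (A B C M X Y : E) : Type v :=
  {z : (Conf B C Y × Conf A Y M) × (M ⟶ X) // IsConflation (z.1.1.1.1 ≫ z.1.2.1.1) z.2}

theorem card_filt (A B C M X Y : E) :
    Nat.card (FiltL A B C M X Y) = Nat.card (FiltR A B C M X Y) := by
  have hL : ∀ z : FiltL A B C M X Y, ∃ a b, a ≫ z.1.2 = z.1.1.2.1.1 ∧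
      b ≫ z.1.1.1.1.1 = z.1.2 ≫ z.1.1.2.1.2 := fun ⟨⟨⟨t, t'⟩, y⟩, hy⟩ => by
    dsimp only at hy
    obtain ⟨a, ha⟩ := hy.lift t'.1.1 (by rw [reassoc_of% t'.2.w, zero_comp])
    obtain ⟨b, hb⟩ := t.2.lift (y ≫ t'.1.2) (by rw [Category.assoc, hy.w])
    exact ⟨a, b, ha, hb⟩
  have hR : ∀ z : FiltR A B C M X Y, ∃ j q, z.1.1.1.1.2 ≫ j = z.1.1.2.1.1 ≫ z.1.2 ∧
      z.1.2 ≫ q = z.1.1.2.1.2 := fun ⟨⟨⟨t, t'⟩, p⟩, hp⟩ => by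
    dsimp only at hp
    obtain ⟨q, hq⟩ := hp.desc t'.1.2 (by rw [Category.assoc, t'.2.w, comp_zero])
    obtain ⟨j, hj⟩ := t.2.desc (t'.1.1 ≫ p) (by rw [← Category.assoc, hp.w])
    exact ⟨j, q, hj, hq⟩
  choose a b ha hb using hL
  choose j q hj hq using hR
  let f : FiltL A B C M X Y → FiltR A B C M X Y := fun z =>
    ⟨((⟨(a z, b z), noether_left z.1.1.1.2 z.1.1.2.2 z.2 (ha z) (hb z)⟩,
      ⟨(z.1.2, z.1.1.2.1.2 ≫ z.1.1.1.1.2), z.2⟩), z.1.1.2.1.2),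
      by simpa only [ha] using z.1.1.2.2⟩
  let g : FiltR A B C M X Y → FiltL A B C M X Y := fun z =>
    ⟨((⟨(j z, q z), noether_right z.1.1.1.2 z.1.1.2.2 z.2 (hq z) (hj z)⟩,
      ⟨(z.1.1.1.1.1 ≫ z.1.1.2.1.1, z.1.2), z.2⟩), z.1.1.2.1.1),
      by simpa only [hq] using z.1.1.2.2⟩
  refine Nat.card_congr ⟨f, g, fun z => ?_, fun z => ?_⟩
  · have hq' : q (f z) = z.1.1.1.1.2 := z.1.1.2.2.desc_hom (hq (f z))
    have hj' : j (f z) = z.1.1.1.1.1 :=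
      (f z).1.1.1.2.desc_hom ((hj (f z)).trans (hb z).symm)
    exact Subtype.ext (Prod.ext (Prod.ext (Subtype.ext (Prod.ext hj' hq'))
      (Subtype.ext (Prod.ext (ha z) rfl))) rfl)
  · have ha' : a (g z) = z.1.1.1.1.1 := z.1.1.2.2.lift_hom (ha (g z))
    have hb' : b (g z) = z.1.1.1.1.2 :=
      (g z).1.1.1.2.lift_hom ((hb (g z)).trans (hj z).symm)
    exact Subtype.ext (Prod.ext (Prod.ext (Subtype.ext (Prod.ext ha' hb'))
      (Subtype.ext (Prod.ext rfl (hq z)))) rfl)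

theorem sum_filtL (A B C M X : E) (T : Finset (IsoClass E))
    (hT : ∀ Y, Nonempty (Conf B C Y) → isoClass Y ∈ T) :
    ∑ y ∈ T, (Nat.card (FiltL A B C M X y.out) : ℚ) / Nat.card (y.out ≅ y.out) =
      (Nat.card (Conf A B X) : ℚ) * Nat.card (Conf X C M) := by
  classical
  have := Fintype.ofFinite (Conf A B X × Conf X C M)
  have h1 : ∀ Y, Nat.card (FiltL A B C M X Y) = ∑ l : Conf A B X × Conf X C M,
      Nat.card {y : Y ⟶ M // IsConflation y (l.2.1.2 ≫ l.1.1.2)} := fun Y => by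
    rw [← Nat.card_sigma]
    exact Nat.card_congr (Equiv.subtypeProdEquivSigmaSubtype
      fun (l : Conf A B X × Conf X C M) (y : Y ⟶ M) => IsConflation y (l.2.1.2 ≫ l.1.1.2))
  simp only [h1, Nat.cast_sum, Finset.sum_div]
  rw [Finset.sum_comm, ← Nat.cast_mul, ← Nat.card_prod, Nat.card_eq_fintype_card,
    ← Finset.card_univ, Finset.card_eq_sum_ones, Nat.cast_sum]
  refine Finset.sum_congr rfl fun l _ => ?_
  obtain ⟨Y₀, y₀, hy₀⟩ := ExactCategory.comp_deflation l.2.1.2 l.1.1.2 ⟨_, _, l.2.2⟩ ⟨_, _, l.1.2⟩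
  replace hy₀ : IsConflation y₀ (l.2.1.2 ≫ l.1.1.2) := hy₀
  have hmem : isoClass Y₀ ∈ T := by
    obtain ⟨a, ha⟩ := hy₀.lift l.2.1.1 (by rw [reassoc_of% l.2.2.w, zero_comp])
    obtain ⟨b, hb⟩ := l.1.2.lift (y₀ ≫ l.2.1.2) (by rw [Category.assoc, hy₀.w])
    exact hT _ ⟨⟨(a, b), noether_left l.1.2 l.2.2 hy₀ ha hb⟩⟩
  simp only [card_kernels hy₀, isoClass, Quotient.out_eq]
  rw [Finset.sum_ite_eq' T]
  simp [hmem]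

theorem sum_filtR (A B C M Y : E) (S : Finset (IsoClass E))
    (hS : ∀ X, Nonempty (Conf A B X) → isoClass X ∈ S) :
    ∑ x ∈ S, (Nat.card (FiltR A B C M x.out Y) : ℚ) / Nat.card (x.out ≅ x.out) =
      (Nat.card (Conf B C Y) : ℚ) * Nat.card (Conf A Y M) := by
  classical
  have := Fintype.ofFinite (Conf B C Y × Conf A Y M)
  have h1 : ∀ X, Nat.card (FiltR A B C M X Y) = ∑ l : Conf B C Y × Conf A Y M,
      Nat.card {p : M ⟶ X // IsConflation (l.1.1.1 ≫ l.2.1.1) p} := fun X => by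
    rw [← Nat.card_sigma]
    exact Nat.card_congr (Equiv.subtypeProdEquivSigmaSubtype
      fun (l : Conf B C Y × Conf A Y M) (p : M ⟶ X) => IsConflation (l.1.1.1 ≫ l.2.1.1) p)
  simp only [h1, Nat.cast_sum, Finset.sum_div]
  rw [Finset.sum_comm, ← Nat.cast_mul, ← Nat.card_prod, Nat.card_eq_fintype_card,
    ← Finset.card_univ, Finset.card_eq_sum_ones, Nat.cast_sum]
  refine Finset.sum_congr rfl fun l _ => ?_
  obtain ⟨X₀, p₀, hp₀⟩ := ExactCategory.comp_inflation l.1.1.1 l.2.1.1 ⟨_, _, l.1.2⟩ ⟨_, _, l.2.2⟩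
  replace hp₀ : IsConflation (l.1.1.1 ≫ l.2.1.1) p₀ := hp₀
  have hmem : isoClass X₀ ∈ S := by
    obtain ⟨q, hq⟩ := hp₀.desc l.2.1.2 (by rw [Category.assoc, l.2.2.w, comp_zero])
    obtain ⟨j, hj⟩ := l.1.2.desc (l.2.1.1 ≫ p₀) (by rw [← Category.assoc, hp₀.w])
    exact hS _ ⟨⟨(j, q), noether_right l.1.2 l.2.2 hp₀ hq hj⟩⟩
  simp only [card_cokernels hp₀, isoClass, Quotient.out_eq]
  rw [Finset.sum_ite_eq' S]
  simp [hmem]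

theorem structureConst_assoc (A B C M : E) (S T : Finset (IsoClass E))
    (hS : ∀ X, Nonempty (Conf A B X) → isoClass X ∈ S)
    (hT : ∀ Y, Nonempty (Conf B C Y) → isoClass Y ∈ T) :
    ∑ x ∈ S, structureConst A B x * structureConst x.out C (isoClass M) =
      ∑ y ∈ T, structureConst B C y * structureConst A y.out (isoClass M) := by
  have h1 : ∀ (A B : E) (x : IsoClass E), structureConst A B x =
      (Nat.card (Conf A B x.out) : ℚ) / Nat.card (x.out ≅ x.out) := fun A B x => by
    rw [← structureConst_eq, isoClass, Quotient.out_eq]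
  have hl : ∀ x ∈ S, structureConst A B x * structureConst x.out C (isoClass M) =
      ∑ y ∈ T, (Nat.card (FiltL A B C M x.out y.out) : ℚ) / Nat.card (y.out ≅ y.out) /
        Nat.card (x.out ≅ x.out) / Nat.card (M ≅ M) := fun x _ => by
    rw [← Finset.sum_div, ← Finset.sum_div, sum_filtL A B C M x.out T hT, h1, structureConst_eq]
    ring
  have hr : ∀ y ∈ T, structureConst B C y * structureConst A y.out (isoClass M) =
      ∑ x ∈ S, (Nat.card (FiltR A B C M x.out y.out) : ℚ) / Nat.card (x.out ≅ x.out) /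
        Nat.card (y.out ≅ y.out) / Nat.card (M ≅ M) := fun y _ => by
    rw [← Finset.sum_div, ← Finset.sum_div, sum_filtR A B C M y.out S hS, h1, structureConst_eq]
    ring
  rw [Finset.sum_congr rfl hl, Finset.sum_congr rfl hr, Finset.sum_comm]
  refine Finset.sum_congr rfl fun y _ => Finset.sum_congr rfl fun x _ => ?_
  rw [card_filt]
  ring

end

end Hall

section HallAlgebra

/-- The underlying `ℚ`-vector space of the Hall algebra of `E`, with basis the isomorphism classes
of objects of `E`. -/
def HallAlgebra (E : Type u) [Category.{v} E] : Type u := IsoClass E →₀ ℚ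

noncomputable instance (E : Type u) [Category.{v} E] : AddCommGroup (HallAlgebra E) :=
  inferInstanceAs (AddCommGroup (IsoClass E →₀ ℚ))

noncomputable instance (E : Type u) [Category.{v} E] : Module ℚ (HallAlgebra E) :=
  inferInstanceAs (Module ℚ (IsoClass E →₀ ℚ))

variable {E : Type u} [Category.{v} E]

/-- The coefficients of an element of the Hall algebra. -/
noncomputable def HallAlgebra.coeff : HallAlgebra E ≃ₗ[ℚ] (IsoClass E →₀ ℚ) := LinearEquiv.refl ℚ _

/-- The basis element of the Hall algebra given by an isomorphism class. -/
noncomputable def HallAlgebra.basis (a : IsoClass E) : HallAlgebra E :=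
  HallAlgebra.coeff.symm (Finsupp.single a (1 : ℚ))

/-- The class `[X]` of an object in the Hall algebra. -/
noncomputable def HallAlgebra.of (X : E) : HallAlgebra E := HallAlgebra.basis (isoClass X)

theorem HallAlgebra.induction {q : HallAlgebra E → Prop} (x : HallAlgebra E) (h0 : q 0)
    (hadd : ∀ x y, q x → q y → q (x + y)) (hsmul : ∀ (r : ℚ) (X : E), q (r • HallAlgebra.of X)) :
    q x := by
  suffices H : ∀ y : IsoClass E →₀ ℚ, q (coeff.symm y) by simpa using H (coeff x)
  intro y
  induction y using Finsupp.induction_linear with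
  | zero => simpa using h0
  | add y z hy hz => simpa using hadd _ _ hy hz
  | single a r =>
    have h := hsmul r a.out
    rw [HallAlgebra.of, isoClass, Quotient.out_eq, basis, ← map_smul, Finsupp.smul_single] at h
    simpa using h

theorem HallAlgebra.ext_coeff {x y : HallAlgebra E} (h : ∀ b, coeff x b = coeff y b) : x = y :=
  coeff.injective (Finsupp.ext h)

theorem HallAlgebra.coeff_basis (a : IsoClass E) : coeff (basis a) = Finsupp.single a 1 :=
  coeff.apply_symm_apply _

variable [Preadditive E] [HasZeroObject E] [HasBinaryBiproducts E] [ExactCategory E]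
  [HomFinite E] [ExtFinite E]

/-- The product `[A] ⋄ [C] = ∑_B |Ext¹(A, C)_B| / |Hom(A, C)| [B]` of two basis elements of the Hall
algebra. -/
noncomputable def hallProduct (a c : IsoClass E) : IsoClass E →₀ ℚ :=
  Quotient.lift₂ (s₁ := isIsomorphicSetoid E) (s₂ := isIsomorphicSetoid E)
    (fun A C : E => Finsupp.ofSupportFinite (structureConst A C)
      ((Set.finite_range (Ext1.middle (A := A) (C := C))).subset fun b hb => by
        by_contra hb'
        have : IsEmpty (Ext1Mid A C b) := ⟨fun ξ => hb' ⟨ξ.1, ξ.2⟩⟩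
        exact hb (by simp [structureConst])))
    (fun _ _ _ _ ⟨a⟩ ⟨c⟩ => Finsupp.ext fun b => congrFun (structureConst_congr a c) b) a c

/-- The Hall product, extended bilinearly. -/
noncomputable def hallMul : HallAlgebra E →ₗ[ℚ] HallAlgebra E →ₗ[ℚ] HallAlgebra E :=
  Finsupp.linearCombination ℚ (fun a => Finsupp.linearCombination ℚ
    (fun c => HallAlgebra.coeff.symm (hallProduct a c)) ∘ₗ HallAlgebra.coeff.toLinearMap) ∘ₗ
    HallAlgebra.coeff.toLinearMap

noncomputable instance : Mul (HallAlgebra E) := ⟨fun x y => hallMul x y⟩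

noncomputable instance : One (HallAlgebra E) := ⟨HallAlgebra.of (0 : E)⟩

namespace HallAlgebra

theorem mul_def (x y : HallAlgebra E) : x * y = hallMul x y := rfl

theorem one_def : (1 : HallAlgebra E) = of (0 : E) := rfl

theorem basis_mul_basis (a c : IsoClass E) :
    basis a * basis c = coeff.symm (hallProduct a c) := by
  simp [mul_def, hallMul, coeff_basis]

theorem hallProduct_apply (A C : E) (b : IsoClass E) :
    hallProduct (isoClass A) (isoClass C) b = structureConst A C b := rfl

theorem coeff_of_mul_of (A C : E) (b : IsoClass E) :
    coeff (of A * of C) b = structureConst A C b := by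
  rw [of, of, basis_mul_basis, LinearEquiv.apply_symm_apply, hallProduct_apply]

theorem of_mul_of_eq_sum (A C : E) : of A * of C =
    ∑ b ∈ (hallProduct (isoClass A) (isoClass C)).support, structureConst A C b • of b.out := by
  have hb : ∀ b : IsoClass E, of b.out = basis b := fun b => by
    rw [of, isoClass, Quotient.out_eq]
  apply coeff.injective
  rw [of, of, basis_mul_basis, LinearEquiv.apply_symm_apply, map_sum]
  conv_lhs => rw [← (hallProduct (isoClass A) (isoClass C)).sum_single]
  refine Finset.sum_congr rfl fun b _ => ?_
  rw [hb, map_smul, coeff_basis, Finsupp.smul_single, hallProduct_apply, smul_eq_mul, mul_one]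

theorem mem_support_hallProduct (A C M : E) (h : Nonempty (Conf A C M)) :
    isoClass M ∈ (hallProduct (isoClass A) (isoClass C)).support := by
  rw [Finsupp.mem_support_iff, hallProduct_apply]
  exact (structureConst_ne_zero_iff A C M).2 h

theorem of_mul_assoc (A B C : E) : of A * of B * of C = of A * (of B * of C) := by
  refine ext_coeff fun m => ?_
  induction m using Quotient.inductionOn with | _ M => ?_
  rw [of_mul_of_eq_sum A B, of_mul_of_eq_sum B C, mul_def, mul_def]
  simp only [map_sum, map_smul, LinearMap.sum_apply, LinearMap.smul_apply, ← mul_def,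
    Finsupp.finsetSum_apply, Finsupp.smul_apply, coeff_of_mul_of, smul_eq_mul]
  exact structureConst_assoc A B C M _ _ (fun X h => mem_support_hallProduct _ _ _ h)
    (fun Y h => mem_support_hallProduct _ _ _ h)

theorem of_mul_of_of_subsingleton {A C : E} (h : Subsingleton (Ext1 A C)) :
    of A * of C = (Nat.card (A ⟶ C) : ℚ)⁻¹ • of (A ⊞ C) := by
  classical
  refine ext_coeff fun b => ?_
  rw [coeff_of_mul_of, map_smul, Finsupp.smul_apply, of, coeff_basis, structureConst,
    Finsupp.single_apply]
  have hs : (splitExt A C).middle = isoClass (A ⊞ C) := rfl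
  split_ifs with hb
  · have : Unique (Ext1Mid A C b) :=
      ⟨⟨splitExt A C, hs.trans hb⟩, fun x => Subsingleton.elim _ _⟩
    rw [Nat.card_unique]
    simp
  · have : IsEmpty (Ext1Mid A C b) :=
      ⟨fun x => hb (by rw [← x.2, Subsingleton.elim x.1 (splitExt A C), hs])⟩
    simp

end HallAlgebra

theorem subsingleton_ext1_zero (C : E) : Subsingleton (Ext1 C (0 : E)) :=
  subsingleton_ext1 fun {Y} i p h => by
    obtain ⟨s, hs⟩ := h.desc (𝟙 Y) ((isZero_zero E).eq_of_src _ _)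
    exact ⟨s, h.desc_hom (by rw [reassoc_of% hs, Category.comp_id])⟩

namespace HallAlgebra

theorem of_congr {A B : E} (e : A ≅ B) : of A = of B := congrArg basis (isoClass_eq.2 ⟨e⟩)

theorem one_mul_of (C : E) : 1 * of C = of C := by
  have : Unique ((0 : E) ⟶ C) := ⟨⟨0⟩, fun f => (isZero_zero E).eq_of_src _ _⟩
  rw [one_def, of_mul_of_of_subsingleton (isProjective_zero C), Nat.card_unique, Nat.cast_one,
    inv_one, one_smul]
  exact of_congr ⟨biprod.snd, biprod.inr, by ext; simp, by simp⟩

theorem mul_of_one (C : E) : of C * 1 = of C := by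
  have : Unique (C ⟶ (0 : E)) := ⟨⟨0⟩, fun f => (isZero_zero E).eq_of_tgt _ _⟩
  rw [one_def, of_mul_of_of_subsingleton (subsingleton_ext1_zero C), Nat.card_unique, Nat.cast_one,
    inv_one, one_smul]
  exact of_congr ⟨biprod.fst, biprod.inl, by ext; simp, by simp⟩

theorem smul_mul (r : ℚ) (x y : HallAlgebra E) : r • x * y = r • (x * y) := by
  simp only [mul_def, map_smul, LinearMap.smul_apply]

theorem mul_smul' (r : ℚ) (x y : HallAlgebra E) : x * r • y = r • (x * y) := by
  simp only [mul_def, map_smul]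

theorem add_mul' (x y z : HallAlgebra E) : (x + y) * z = x * z + y * z := by
  simp only [mul_def, map_add, LinearMap.add_apply]

theorem mul_add' (x y z : HallAlgebra E) : x * (y + z) = x * y + x * z := by
  simp only [mul_def, map_add]

theorem zero_mul' (x : HallAlgebra E) : 0 * x = 0 := by
  simp only [mul_def, map_zero, LinearMap.zero_apply]

theorem mul_zero' (x : HallAlgebra E) : x * 0 = 0 := by
  simp only [mul_def, map_zero]

theorem mul_assoc' (x y z : HallAlgebra E) : x * y * z = x * (y * z) := by
  induction x using HallAlgebra.induction with
  | h0 => simp only [zero_mul']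
  | hadd x x' hx hx' => simp only [add_mul', hx, hx']
  | hsmul r A =>
    induction y using HallAlgebra.induction with
    | h0 => simp only [zero_mul', mul_zero']
    | hadd y y' hy hy' => simp only [mul_add', add_mul', hy, hy']
    | hsmul s B =>
      induction z using HallAlgebra.induction with
      | h0 => simp only [mul_zero']
      | hadd z z' hz hz' => simp only [mul_add', hz, hz']
      | hsmul t C => simp only [smul_mul, mul_smul', of_mul_assoc]

end HallAlgebra

/-- The Hall algebra of a Hom-finite and Ext-finite exact category is an associative unital ring,
with unit the class of the zero object. -/
noncomputable instance : Ring (HallAlgebra E) where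
  __ := (inferInstance : AddCommGroup (HallAlgebra E))
  left_distrib := HallAlgebra.mul_add'
  right_distrib := HallAlgebra.add_mul'
  zero_mul := HallAlgebra.zero_mul'
  mul_zero := HallAlgebra.mul_zero'
  mul_assoc := HallAlgebra.mul_assoc'
  one_mul x := by
    induction x using HallAlgebra.induction with
    | h0 => exact HallAlgebra.mul_zero' _
    | hadd x y hx hy => rw [HallAlgebra.mul_add', hx, hy]
    | hsmul r A => rw [HallAlgebra.mul_smul', HallAlgebra.one_mul_of]
  mul_one x := by
    induction x using HallAlgebra.induction with
    | h0 => exact HallAlgebra.zero_mul' _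
    | hadd x y hx hy => rw [HallAlgebra.add_mul', hx, hy]
    | hsmul r A => rw [HallAlgebra.smul_mul, HallAlgebra.mul_of_one]

noncomputable instance : Algebra ℚ (HallAlgebra E) :=
  Algebra.ofModule HallAlgebra.smul_mul HallAlgebra.mul_smul'

end HallAlgebra

section Frobenius

variable {F : Type u} [Category.{v} F] [Preadditive F] [HasZeroObject F] [HasBinaryBiproducts F]
  [ExactCategory F]

/-- The projective-injective objects of `F`. -/
def IsProjInj (X : F) : Prop := IsProjective X ∧ IsInjective X

theorem isProjInj_iff [IsFrobenius F] (X : F) : IsProjInj X ↔ IsProjective X :=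
  ⟨fun h => h.1, fun h => ⟨h, (IsFrobenius.projective_iff_injective X).1 h⟩⟩

theorem isProjInj_biprod [IsFrobenius F] {P Q : F} (hP : IsProjInj P) (hQ : IsProjInj Q) :
    IsProjInj (P ⊞ Q) := (isProjInj_iff _).2 (isProjective_biprod hP.1 hQ.1)

theorem isProjInj_zero [IsFrobenius F] : IsProjInj (0 : F) := (isProjInj_iff _).2 isProjective_zero

/-! ### The stable category -/

variable (F) in
/-- Two parallel morphisms are stably equal if their difference factors through a
projective-injective object. -/
def stableRel : HomRel F := fun X Y f g =>
  ∃ P : F, IsProjInj P ∧ ∃ (a : X ⟶ P) (b : P ⟶ Y), f - g = a ≫ b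

instance [IsFrobenius F] : Congruence (stableRel F) where
  equivalence :=
    { refl := fun f => ⟨0, isProjInj_zero, 0, 0, by simp⟩
      symm := fun ⟨P, hP, a, b, h⟩ => ⟨P, hP, -a, b, by rw [Preadditive.neg_comp, ← h, neg_sub]⟩
      trans := fun ⟨P, hP, a, b, h⟩ ⟨Q, hQ, c, d, h'⟩ => ⟨P ⊞ Q, isProjInj_biprod hP hQ,
        biprod.lift a c, biprod.desc b d, by rw [biprod.lift_desc, ← h, ← h', sub_add_sub_cancel]⟩ }
  comp_left := fun f _ _ ⟨P, hP, a, b, h⟩ =>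
    ⟨P, hP, f ≫ a, b, by rw [← Preadditive.comp_sub, h, Category.assoc]⟩
  comp_right := fun g ⟨P, hP, a, b, h⟩ =>
    ⟨P, hP, a, b ≫ g, by rw [← Preadditive.sub_comp, h, Category.assoc]⟩

variable (F) in
/-- The stable category of `F`: the same objects, and the morphisms of `F` modulo those which factor
through a projective-injective object. -/
abbrev StableCategory := CategoryTheory.Quotient (stableRel F)

/-! ### The Grothendieck group of the projective-injective objects -/

/-- The defining relations `[Y] = [X] + [Z]` of the Grothendieck group of the full subcategory of
`F` on the objects satisfying `P`, one for each conflation `X ↣ Y ↠ Z` with terms in `P`. -/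
def K0Relations (P : ObjectProperty F) : AddSubgroup (FreeAbelianGroup P.FullSubcategory) :=
  AddSubgroup.closure {z | ∃ (X Y Z : P.FullSubcategory) (i : X.obj ⟶ Y.obj) (p : Y.obj ⟶ Z.obj),
    IsConflation i p ∧
      z = FreeAbelianGroup.of Y - FreeAbelianGroup.of X - FreeAbelianGroup.of Z}

variable (F) in
/-- `K₀(𝒫(F))`, the Grothendieck group of the full subcategory of projective-injective objects. -/
abbrev K0ProjInj : Type u :=
  FreeAbelianGroup (ObjectProperty.FullSubcategory (IsProjInj (F := F))) ⧸
    K0Relations (F := F) IsProjInj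

/-! ### The semi-derived Hall algebra -/

section

variable [IsFrobenius F] [HomFinite F]

theorem of_proj_mul {P : F} (hP : IsProjInj P) (C : F) : HallAlgebra.of P * HallAlgebra.of C =
    (Nat.card (P ⟶ C) : ℚ)⁻¹ • HallAlgebra.of (P ⊞ C) :=
  HallAlgebra.of_mul_of_of_subsingleton (hP.1 C)

theorem mul_of_proj {P : F} (hP : IsProjInj P) (C : F) : HallAlgebra.of C * HallAlgebra.of P =
    (Nat.card (C ⟶ P) : ℚ)⁻¹ • HallAlgebra.of (P ⊞ C) := by
  rw [HallAlgebra.of_mul_of_of_subsingleton (hP.2 C),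
    HallAlgebra.of_congr (biprod.braiding C P)]

variable (F) in
/-- The multiplicative set generated by the classes of the projective-injective objects. -/
noncomputable def projClasses : Submonoid (HallAlgebra F) :=
  Submonoid.closure {x | ∃ P : F, IsProjInj P ∧ x = HallAlgebra.of P}

theorem exists_proj_mul {P : F} (hP : IsProjInj P) (x : HallAlgebra F) :
    ∃ y, HallAlgebra.of P * x = y * HallAlgebra.of P := by
  induction x using HallAlgebra.induction with
  | h0 => exact ⟨0, by simp⟩
  | hadd x x' hx hx' =>
    obtain ⟨y, hy⟩ := hx
    obtain ⟨y', hy'⟩ := hx'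
    exact ⟨y + y', by rw [mul_add, add_mul, hy, hy']⟩
  | hsmul r C =>
    refine ⟨(r * (Nat.card (P ⟶ C) : ℚ)⁻¹ * Nat.card (C ⟶ P)) • HallAlgebra.of C, ?_⟩
    rw [mul_smul_comm, smul_mul_assoc, of_proj_mul hP, mul_of_proj hP, smul_smul, smul_smul,
      mul_assoc _ (Nat.card (C ⟶ P) : ℚ), mul_inv_cancel₀ (card_hom_ne_zero C P), mul_one]

theorem coeff_proj_mul {P : F} (hP : IsProjInj P) (x : HallAlgebra F) (B : F) :
    HallAlgebra.coeff (HallAlgebra.of P * x) (isoClass B) * Nat.card (P ⟶ B) =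
      HallAlgebra.coeff (x * HallAlgebra.of P) (isoClass B) * Nat.card (B ⟶ P) := by
  classical
  induction x using HallAlgebra.induction with
  | h0 => simp
  | hadd x y hx hy => simp only [mul_add, add_mul, map_add, Finsupp.add_apply, hx, hy]
  | hsmul r C =>
    rw [mul_smul_comm, smul_mul_assoc, of_proj_mul hP, mul_of_proj hP, HallAlgebra.of]
    simp only [map_smul, Finsupp.smul_apply, HallAlgebra.coeff_basis, Finsupp.single_apply]
    split_ifs with h
    · obtain ⟨e⟩ := isoClass_eq.1 h
      have h1 : Nat.card (P ⟶ B) = Nat.card (P ⟶ P) * Nat.card (P ⟶ C) := by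
        rw [← Nat.card_prod]
        exact Nat.card_congr
          { toFun := fun f => ((f ≫ e.inv) ≫ biprod.fst, (f ≫ e.inv) ≫ biprod.snd)
            invFun := fun z => biprod.lift z.1 z.2 ≫ e.hom
            left_inv := fun f => by
              rw [← Iso.eq_comp_inv]
              ext <;> simp
            right_inv := fun z => by simp }
      have h2 : Nat.card (B ⟶ P) = Nat.card (P ⟶ P) * Nat.card (C ⟶ P) := by
        rw [← Nat.card_prod]
        exact Nat.card_congr
          { toFun := fun f => (biprod.inl ≫ e.hom ≫ f, biprod.inr ≫ e.hom ≫ f)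
            invFun := fun z => e.inv ≫ biprod.desc z.1 z.2
            left_inv := fun f => by
              rw [Iso.inv_comp_eq]
              ext <;> simp
            right_inv := fun z => by simp }
      have h3 := card_hom_ne_zero P C
      have h4 := card_hom_ne_zero C P
      rw [h1, h2]
      push_cast
      simp only [smul_eq_mul]
      field_simp
    · simp

theorem proj_mul_eq_zero {P : F} (hP : IsProjInj P) (x : HallAlgebra F)
    (h : x * HallAlgebra.of P = 0) : HallAlgebra.of P * x = 0 := by
  refine HallAlgebra.ext_coeff fun b => ?_
  induction b using Quotient.inductionOn with | _ B => ?_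
  have := coeff_proj_mul hP x B
  rw [h] at this
  simpa [card_hom_ne_zero P B] using this

theorem exists_projClasses_mul (s : HallAlgebra F) (hs : s ∈ projClasses F) (x : HallAlgebra F) :
    ∃ y, s * x = y * s := by
  induction hs using Submonoid.closure_induction generalizing x with
  | mem s hs =>
    obtain ⟨P, hP, rfl⟩ := hs
    exact exists_proj_mul hP x
  | one => exact ⟨x, by simp⟩
  | mul s t _ _ hs ht =>
    obtain ⟨y, hy⟩ := ht x
    obtain ⟨z, hz⟩ := hs y
    exact ⟨z, by rw [mul_assoc, hy, ← mul_assoc, hz, mul_assoc]⟩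

theorem projClasses_mul_eq_zero (s : HallAlgebra F) (hs : s ∈ projClasses F) (x : HallAlgebra F)
    (h : x * s = 0) : s * x = 0 := by
  induction hs using Submonoid.closure_induction generalizing x with
  | mem s hs =>
    obtain ⟨P, hP, rfl⟩ := hs
    exact proj_mul_eq_zero hP x h
  | one => simpa using h
  | mul s t _ _ hs ht =>
    rw [mul_assoc]
    exact hs _ (by rw [mul_assoc]; exact ht _ (by rw [mul_assoc, h]))

/-- The classes of the projective-injective objects satisfy the Ore conditions. -/
noncomputable instance : OreLocalization.OreSet (projClasses F) :=
  Classical.choice <| OreLocalization.nonempty_oreSet_iff.2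
    ⟨fun x y s h => ⟨s, sub_eq_zero.1 (by
      rw [← mul_sub]
      exact projClasses_mul_eq_zero s.1 s.2 _ (by rw [sub_mul, h, sub_self]))⟩,
    fun x s => (exists_projClasses_mul s.1 s.2 x).elim fun y hy => ⟨y, s, hy⟩⟩

variable (F) in
/-- The semi-derived Hall algebra: the localization of the Hall algebra of `F` at the classes of
all projective-injective objects. -/
abbrev SemiDerivedHallAlgebra : Type u := OreLocalization (projClasses F) (HallAlgebra F)

variable (F) in
/-- The localization map from the Hall algebra to the semi-derived Hall algebra. -/
noncomputable abbrev toSDH : HallAlgebra F →* SemiDerivedHallAlgebra F :=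
  OreLocalization.numeratorHom

end

end Frobenius

section Functoriality

/-- The map of Hall algebras `[M] ↦ [Φ M]` induced by a functor `Φ`. -/
noncomputable def HallAlgebra.map {E' : Type*} [Category* E'] {E : Type*} [Category* E]
    (Φ : E' ⥤ E) : HallAlgebra E' →ₗ[ℚ] HallAlgebra E :=
  HallAlgebra.coeff.symm.toLinearMap ∘ₗ Finsupp.lmapDomain ℚ ℚ
    (Quotient.map (sa := isIsomorphicSetoid E') (sb := isIsomorphicSetoid E) Φ.obj
      fun _ _ ⟨e⟩ => ⟨Φ.mapIso e⟩) ∘ₗ HallAlgebra.coeff.toLinearMap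

theorem HallAlgebra.map_of {E' : Type*} [Category* E'] {E : Type*} [Category* E]
    (Φ : E' ⥤ E) (M : E') : HallAlgebra.map Φ (HallAlgebra.of M) = HallAlgebra.of (Φ.obj M) := by
  apply HallAlgebra.coeff.injective
  simp only [HallAlgebra.map, HallAlgebra.of, LinearMap.comp_apply, LinearEquiv.coe_coe,
    HallAlgebra.coeff_basis, LinearEquiv.apply_symm_apply]
  rw [Finsupp.lmapDomain_apply, Finsupp.mapDomain_single]
  rfl

variable {F' : Type*} [Category* F'] [Preadditive F'] [HasZeroObject F'] [HasBinaryBiproducts F']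
  [ExactCategory F']
  {F : Type*} [Category* F] [Preadditive F] [HasZeroObject F] [HasBinaryBiproducts F]
  [ExactCategory F]

/-- A map of Frobenius categories: an exact functor (additive, and sending conflations to
conflations) which sends projective-injective objects to projective-injective objects. -/
structure IsFrobeniusMap (Φ : F' ⥤ F) : Prop where
  additive : Φ.Additive
  map_conflation : ∀ {X Y Z : F'} {i : X ⟶ Y} {p : Y ⟶ Z},
    IsConflation i p → IsConflation (Φ.map i) (Φ.map p)
  map_projInj : ∀ {X : F'}, IsProjInj X → IsProjInj (Φ.obj X)

namespace IsFrobeniusMap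

variable {Φ : F' ⥤ F} (hΦ : IsFrobeniusMap Φ)

/-- The functor between the stable categories induced by a map of Frobenius categories. -/
def stableFunctor : StableCategory F' ⥤ StableCategory F :=
  CategoryTheory.Quotient.lift (stableRel F') (Φ ⋙ CategoryTheory.Quotient.functor (stableRel F))
    fun _ _ _ _ ⟨P, hP, a, b, h⟩ => CategoryTheory.Quotient.sound (stableRel F)
      ⟨Φ.obj P, hΦ.map_projInj hP, Φ.map a, Φ.map b, by
        have := hΦ.additive
        rw [← Φ.map_sub, h, Φ.map_comp]⟩

/-- The homomorphism `[P] ↦ [Φ P]` between the Grothendieck groups of projective-injective objects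
induced by a map of Frobenius categories. -/
def mapK0 : K0ProjInj F' →+ K0ProjInj F :=
  QuotientAddGroup.map _ _
    (FreeAbelianGroup.map fun P : ObjectProperty.FullSubcategory (IsProjInj (F := F')) =>
      (⟨Φ.obj P.obj, hΦ.map_projInj P.property⟩ :
        ObjectProperty.FullSubcategory (IsProjInj (F := F)))) <| by
    rw [K0Relations, AddSubgroup.closure_le]
    rintro _ ⟨X, Y, Z, i, p, h, rfl⟩
    refine AddSubgroup.subset_closure ⟨⟨_, hΦ.map_projInj X.property⟩,
      ⟨_, hΦ.map_projInj Y.property⟩, ⟨_, hΦ.map_projInj Z.property⟩, Φ.map i, Φ.map p,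
      hΦ.map_conflation h, ?_⟩
    simp only [map_sub, FreeAbelianGroup.map_of_apply]

end IsFrobeniusMap

end Functoriality

end SemiDerivedHall

/-! An extension of `A` by `C` is the pushout of a projective presentation `K ↣ P ↠ A` along some
morphism `K ⟶ C`. A fully faithful `Φ` that preserves conflations and projective-injectives carries
the presentation to one of `Φ A`, and fullness lifts the morphism, so every conflation of `F` with
end terms in the image comes from `F'` (`exists_conflation_lift`). Structure constants therefore
agree, and `[M] ↦ [Φ M]` is an injective homomorphism of Hall algebras. It sends classes of
projective-injectives to such classes, hence extends to the localizations (`sdhHom`).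

Injectivity of the extension requires that localizing loses nothing. In a Hom-finite idempotent
complete additive category direct summands cancel (`nonempty_iso_of_biprod_iso`), so `P ⊞ C`
determines `C`, and left multiplication by `[P]` sends the basis to nonzero multiples of distinct
basis elements. Hence the Hall algebra embeds in its localization (`toSDHAlgHom_injective`).

For surjectivity, conflations of projective-injectives split, so `K₀` of them maps to the group
completion of the monoid of isomorphism classes, and by cancellation that monoid embeds in its
completion. Surjectivity on `K₀` thus yields `Q ⊞ Φ P ≅ Φ P'` for every projective-injective `Q`.
Essential surjectivity on stable categories yields `P ⊞ M ≅ Q ⊞ Φ N` for every `M`. Since `[P ⊞ M]`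
is a nonzero multiple of `[P] ⋄ [M]` and `[P]` is invertible, these isomorphisms can be solved for
`[Q]`, `[Q]⁻¹` and `[M]` inside the image (`sdhHom_surjective`). -/

namespace SemiDerivedHall

/-! ### Finite endomorphism monoids -/

/-- In a finite monoid, every element has an idempotent power. -/
theorem exists_isIdempotentElem_pow {M : Type*} [Monoid M] [Finite M] (x : M) :
    ∃ n, n ≠ 0 ∧ IsIdempotentElem (x ^ n) := by
  obtain ⟨i, j, hne, hij⟩ := Finite.exists_ne_map_eq_of_infinite fun n : ℕ => x ^ n
  wlog hlt : i < j generalizing i j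
  · exact this j i hne.symm hij.symm (by omega)
  obtain ⟨k, rfl⟩ := Nat.exists_eq_add_of_lt hlt
  have period : ∀ m l, x ^ (i + l + m * (k + 1)) = x ^ (i + l) := fun m l => by
    induction m with
    | zero => simp
    | succ m ih =>
      calc x ^ (i + l + (m + 1) * (k + 1)) = x ^ (i + k + 1) * x ^ (l + m * (k + 1)) := by
            rw [← pow_add]; ring_nf
        _ = x ^ (i + l) := by
            rw [← ih, ← show x ^ i = x ^ (i + k + 1) from hij, ← pow_add]; ring_nf
  -- The powers of `x` have period `k + 1` from exponent `i` on. The exponent chosen is a multiple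
  -- of the period that is at least `i`, and the factor `i + 1` keeps it nonzero when `i = 0`.
  refine ⟨(i + 1) * (k + 1), by positivity, ?_⟩
  have h : (i + 1) * (k + 1) = i + (1 + i * k + k) := by ring
  rw [IsIdempotentElem, ← pow_add]
  conv_rhs => rw [h, ← period (i + 1), ← h]

/-- Sandwiching by `r` and `i` embeds the endomorphisms of `B` in those of `A`. Equal cardinalities
would put `𝟙 A` in the image and make the retract improper. This is the decreasing measure in the
cancellation induction. -/
theorem card_end_lt_of_retract {E : Type u} [Category.{v} E] [HomFinite E] {A B : E}
    (i : B ⟶ A) (r : A ⟶ B) (h : i ≫ r = 𝟙 B)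
    (hne : r ≫ i ≠ 𝟙 A) : Nat.card (B ⟶ B) < Nat.card (A ⟶ A) := by
  have hinj : Function.Injective fun f : B ⟶ B => r ≫ f ≫ i := fun f g hfg => by
    simpa [h, reassoc_of% h] using congrArg (fun z => i ≫ z ≫ r) hfg
  refine lt_of_le_of_ne (Nat.card_le_card_of_injective _ hinj) fun hcard => hne ?_
  obtain ⟨f, hf⟩ := ((Nat.bijective_iff_injective_and_card _).2 ⟨hinj, hcard⟩).surjective (𝟙 A)
  dsimp only at hf
  calc r ≫ i = (r ≫ f ≫ i) ≫ r ≫ i := by rw [hf, Category.id_comp]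
    _ = 𝟙 A := by rw [Category.assoc, Category.assoc, reassoc_of% h, hf]

theorem nonempty_iso_biprod_congr {E : Type u} [Category.{v} E] [Preadditive E]
    [HasBinaryBiproducts E] {A B C D : E} (h : Nonempty (A ≅ B)) (h' : Nonempty (C ≅ D)) :
    Nonempty (A ⊞ C ≅ B ⊞ D) := h.elim fun e => h'.elim fun e' => ⟨biprod.mapIso e e'⟩

/-! ### Cancellation of direct summands -/

section Cancellation

variable {E : Type u} [Category.{v} E] [Preadditive E] [HasBinaryBiproducts E]

/-- Cancellation of `A` in `A ⊞ X ≅ A ⊞ Y`, when the component `A ⟶ A` of the isomorphism becomes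
invertible after adding a morphism which factors through the component `X ⟶ A`. -/
theorem nonempty_iso_of_biprod_iso_of_isIso {A X Y : E} (e : A ⊞ X ≅ A ⊞ Y) (t : A ⟶ X)
    (ht : IsIso (biprod.lift (𝟙 A) t ≫ e.hom ≫ biprod.fst)) : Nonempty (X ≅ Y) := by
  let f : A ⊞ X ⟶ A := e.hom ≫ biprod.fst
  let u : A ⟶ A := biprod.lift (𝟙 A) t ≫ f
  have hu : IsIso u := ht
  -- Since `f` restricts to the isomorphism `u` on the graph of `t`, that graph is a complement of
  -- the kernel of `f`. Here `ρ` is the quotient by the graph and `κ` identifies `X` with the kernel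
  -- of `f`. Through `e` the same kernel is `Y`.
  let ρ : A ⊞ X ⟶ X := biprod.desc (-t) (𝟙 X)
  let κ : X ⟶ A ⊞ X := biprod.inr ≫ (𝟙 _ - f ≫ inv u ≫ biprod.lift (𝟙 A) t)
  have h1 : κ ≫ f = 0 := by
    simp only [κ, Category.assoc, Preadditive.sub_comp, Category.id_comp]
    rw [show biprod.lift (𝟙 A) t ≫ f = u from rfl, IsIso.inv_hom_id, Category.comp_id, sub_self,
      comp_zero]
  have h2 : biprod.lift (𝟙 A) t ≫ ρ = 0 := by simp [ρ]
  have h3 : κ ≫ ρ = 𝟙 X := by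
    simp only [κ, Category.assoc, Preadditive.sub_comp, Category.id_comp, h2, comp_zero, sub_zero]
    simp [ρ]
  have h4 : ρ ≫ biprod.inr = 𝟙 _ - biprod.fst ≫ biprod.lift (𝟙 A) t := by
    ext <;> simp [ρ]
  have h5 : ρ ≫ κ = 𝟙 _ - f ≫ inv u ≫ biprod.lift (𝟙 A) t := by
    simp only [κ, Preadditive.comp_sub, Category.comp_id, h4]
    rw [reassoc_of% h4, Preadditive.sub_comp, Category.id_comp]
    simp only [Category.assoc]
    rw [show biprod.lift (𝟙 A) t ≫ f ≫ inv u ≫ biprod.lift (𝟙 A) t = biprod.lift (𝟙 A) t by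
      rw [← Category.assoc, show biprod.lift (𝟙 A) t ≫ f = u from rfl, IsIso.hom_inv_id_assoc]]
    abel
  have h6 : (biprod.snd : A ⊞ Y ⟶ Y) ≫ biprod.inr = 𝟙 _ - biprod.fst ≫ biprod.inl :=
    eq_sub_of_add_eq' biprod.total
  have h7 : (biprod.inr : Y ⟶ A ⊞ Y) ≫ e.inv ≫ f = 0 := by simp [f]
  refine ⟨⟨κ ≫ e.hom ≫ biprod.snd, biprod.inr ≫ e.inv ≫ ρ, ?_, ?_⟩⟩
  · simp only [Category.assoc, reassoc_of% h6, Preadditive.sub_comp, Preadditive.comp_sub,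
      Category.id_comp, Iso.hom_inv_id_assoc, h3]
    rw [show κ ≫ e.hom ≫ biprod.fst ≫ biprod.inl ≫ e.inv ≫ ρ = (κ ≫ f) ≫ biprod.inl ≫ e.inv ≫ ρ by
      simp [f], h1, zero_comp, sub_zero]
  · simp only [Category.assoc, reassoc_of% h5, Preadditive.sub_comp, Preadditive.comp_sub,
      Category.id_comp, Iso.inv_hom_id_assoc, reassoc_of% h7, zero_comp, sub_zero]
    simp

variable [HomFinite E]

instance (A : E) : Finite (End A) := inferInstanceAs (Finite (A ⟶ A))

/-- Some power of `a' ≫ a` is idempotent, hence `0` or `𝟙 A`, so `a' ≫ a` is nilpotent or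
invertible. As `a' ≫ a + b' ≫ b = 𝟙 A`, one of the two summands is invertible, as if `End A` were
known to be local. -/
theorem nonempty_iso_of_biprod_iso_of_local {A X Y : E}
    (hA : ∀ f : A ⟶ A, f ≫ f = f → f = 0 ∨ f = 𝟙 A) (e : A ⊞ X ≅ A ⊞ Y) :
    Nonempty (X ≅ Y) := by
  let a : A ⟶ A := biprod.inl ≫ e.hom ≫ biprod.fst
  let a' : A ⟶ A := biprod.inl ≫ e.inv ≫ biprod.fst
  let b : X ⟶ A := biprod.inr ≫ e.hom ≫ biprod.fst
  let b' : A ⟶ X := biprod.inl ≫ e.inv ≫ biprod.snd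
  have hc : a' ≫ a + b' ≫ b = 𝟙 A := by
    have : (biprod.inl : A ⟶ A ⊞ Y) ≫ e.inv ≫ (biprod.fst ≫ biprod.inl + biprod.snd ≫ biprod.inr) ≫
      e.hom ≫ biprod.fst = 𝟙 A := by rw [biprod.total]; simp
    simpa only [a, a', b, b', Preadditive.add_comp, Preadditive.comp_add, Category.assoc] using this
  obtain ⟨n, hn, hid⟩ := exists_isIdempotentElem_pow (M := End A) (a' ≫ a)
  rcases hA _ hid with h | h
  · have : IsIso (b' ≫ b) := by
      rw [← isUnit_iff_isIso, eq_sub_of_add_eq' hc]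
      exact IsNilpotent.isUnit_one_sub (R := End A) ⟨n, h⟩
    -- The correction `t` is chosen so that `a + t ≫ b = 𝟙 A`.
    refine nonempty_iso_of_biprod_iso_of_isIso e ((𝟙 A - a) ≫ inv (b' ≫ b) ≫ b') ?_
    have h1 : biprod.lift (𝟙 A) ((𝟙 A - a) ≫ inv (b' ≫ b) ≫ b') ≫ e.hom ≫ biprod.fst = 𝟙 A := by
      rw [biprod.lift_eq, Preadditive.add_comp]
      simp only [Category.assoc, Category.id_comp]
      change a + (𝟙 A - a) ≫ inv (b' ≫ b) ≫ b' ≫ b = 𝟙 A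
      simp
    rw [h1]
    infer_instance
  · have hu : IsUnit (M := End A) (a' ≫ a) :=
      (isUnit_pow_iff hn).1 (by rw [show (show End A from a' ≫ a) ^ n = 1 from h]; exact isUnit_one)
    have : IsIso (a' ≫ a) := (isUnit_iff_isIso _).1 hu
    -- A one-sided inverse of `a` is enough because `End A` is a finite monoid.
    have hau : IsUnit (M := End A) a := by
      refine IsUnit.of_mul_eq_one (M := End A) (inv (a' ≫ a) ≫ a') ?_
      change (inv (a' ≫ a) ≫ a') ≫ a = 𝟙 A
      simp
    refine nonempty_iso_of_biprod_iso_of_isIso e 0 ?_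
    have h1 : biprod.lift (𝟙 A) (0 : A ⟶ X) ≫ e.hom ≫ biprod.fst = a := by
      rw [biprod.lift_eq]
      simp [a]
    rw [h1]
    exact (isUnit_iff_isIso a).1 hau

/-- Objects of a Hom-finite idempotent complete additive category can be cancelled from direct
sums. -/
theorem nonempty_iso_of_biprod_iso [IsIdempotentComplete E] {A X Y : E} (e : A ⊞ X ≅ A ⊞ Y) :
    Nonempty (X ≅ Y) := by
  induction hn : Nat.card (A ⟶ A) using Nat.strong_induction_on generalizing A X Y with
  | _ n ih =>
  by_cases hA : ∀ f : A ⟶ A, f ≫ f = f → f = 0 ∨ f = 𝟙 A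
  · exact nonempty_iso_of_biprod_iso_of_local hA e
  push Not at hA
  -- A nontrivial idempotent splits `A` as `B ⊞ C` with strictly fewer endomorphisms on each
  -- summand. Cancelling `B` and then `C` falls under the induction hypothesis.
  obtain ⟨f, hf, hf0, hf1⟩ := hA
  obtain ⟨B, i, r, hir, hri⟩ := IsIdempotentComplete.idempotents_split A f hf
  obtain ⟨C, j, s, hjs, hsj⟩ := IsIdempotentComplete.idempotents_split A (𝟙 A - f)
    (Idempotents.idem_of_id_sub_idem f hf)
  have his : i ≫ s = 0 := by
    have h : i ≫ (𝟙 A - f) = 0 := by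
      rw [← hri, Preadditive.comp_sub, reassoc_of% hir, Category.comp_id, sub_self]
    rw [← hsj] at h
    simpa [hjs] using congrArg (· ≫ s) h
  have hjr : j ≫ r = 0 := by
    have h : j ≫ f = 0 := by
      have : j ≫ (𝟙 A - f) = j := by rw [← hsj, reassoc_of% hjs]
      simpa using this
    rw [← hri] at h
    simpa [hir] using congrArg (· ≫ r) h
  have htot : r ≫ i + s ≫ j = 𝟙 A := by rw [hri, hsj]; abel
  let d : ∀ Z : E, A ⊞ Z ≅ B ⊞ (C ⊞ Z) := fun Z =>
    { hom := biprod.lift (biprod.fst ≫ r) (biprod.lift (biprod.fst ≫ s) biprod.snd)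
      inv := biprod.desc (i ≫ biprod.inl) (biprod.desc (j ≫ biprod.inl) biprod.inr)
      hom_inv_id := by
        rw [biprod.lift_desc, biprod.lift_desc]
        ext <;> simp [htot]
      inv_hom_id := by
        ext <;> simp [hir, hjs, his, hjr] }
  have hB := card_end_lt_of_retract i r hir (fun h => hf1 (hri.symm.trans h))
  have hC := card_end_lt_of_retract j s hjs (fun h => hf0 (by
    rw [hsj] at h
    simpa using h))
  obtain ⟨e₁⟩ := ih _ (hn ▸ hB) ((d X).symm ≪≫ e ≪≫ d Y) rfl
  exact ih _ (hn ▸ hC) e₁ rfl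

end Cancellation

/-! ### Pushouts of conflations and stable isomorphisms -/

section Exact

variable {E : Type u} [Category.{v} E] [Preadditive E] [HasZeroObject E] [HasBinaryBiproducts E]
  [ExactCategory E]

/-- The pushout of a conflation along a morphism from its first term. -/
theorem IsConflation.exists_pushout {K P A C : E} {k : K ⟶ P} {q : P ⟶ A} (hk : IsConflation k q)
    (f : K ⟶ C) : ∃ (W : E) (g : C ⟶ W) (m : P ⟶ W) (r : W ⟶ A),
      IsPushout k f m g ∧ IsConflation g r ∧ m ≫ r = q := by
  obtain ⟨W, g, m, sq, Z, p, hp⟩ := ExactCategory.pushout_inflation k f ⟨_, _, hk⟩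
  replace hp : IsConflation g p := hp
  have hmr : m ≫ sq.desc q 0 (by rw [hk.w, comp_zero]) = q := sq.inl_desc _ _ _
  have hgr : g ≫ sq.desc q 0 (by rw [hk.w, comp_zero]) = 0 := sq.inr_desc _ _ _
  refine ⟨W, g, m, sq.desc q 0 (by rw [hk.w, comp_zero]), sq, hp.of_cokernel _ hgr
    (fun t ht => ?_) (fun a b hab => hk.desc_hom ?_), hmr⟩
  · obtain ⟨u, hu⟩ := hk.desc (m ≫ t) (by rw [reassoc_of% sq.w, ht, comp_zero])
    exact ⟨u, sq.hom_ext (by rw [reassoc_of% hmr, hu])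
      (by rw [reassoc_of% hgr, zero_comp, ht])⟩
  · rw [← hmr, Category.assoc, hab, Category.assoc]

/-- A morphism of conflations with the same last term exhibits the second one as the pushout of the
first one. -/
theorem IsConflation.exists_iso_of_pushout {K P A C W M : E} {k : K ⟶ P} {f : K ⟶ C} {g : C ⟶ W}
    {m : P ⟶ W} {r : W ⟶ A} (sq : IsPushout k f m g) (hg : IsConflation g r) {j : C ⟶ M}
    {q' : M ⟶ A} (hj : IsConflation j q') (l : P ⟶ M) (hl : l ≫ q' = m ≫ r)
    (hkl : k ≫ l = f ≫ j) : ∃ e : W ≅ M, g ≫ e.hom = j ∧ e.hom ≫ q' = r := by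
  have h1 : g ≫ sq.desc l j hkl = j := sq.inr_desc _ _ _
  have h2 : sq.desc l j hkl ≫ q' = r :=
    sq.hom_ext (by rw [sq.inl_desc_assoc, hl]) (by rw [sq.inr_desc_assoc, hj.w, hg.w])
  have := hg.isIso_of_hom hj _ h1 h2
  exact ⟨asIso (sq.desc l j hkl), h1, h2⟩

/-- A retract of a projective object is projective. -/
theorem IsProjective.of_retract {P Q : E} (hP : IsProjective P) (a : Q ⟶ P) (b : P ⟶ Q)
    (h : a ≫ b = 𝟙 Q) : IsProjective Q := isProjective_of_lift fun i p hp => by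
  obtain ⟨t, ht⟩ := hP.exists_lift hp b
  exact ⟨a ≫ t, by rw [Category.assoc, ht, h]⟩

/-- Morphisms to an injective object extend along inflations. -/
theorem IsInjective.exists_ext {I : E} (hI : IsInjective I) {X Y Z : E} {i : X ⟶ Y} {p : Y ⟶ Z}
    (h : IsConflation i p) (f : X ⟶ I) : ∃ g : Y ⟶ I, i ≫ g = f := by
  -- The pushed-out extension of `Z` by `I` splits, and its retraction onto `I` composed with `m`
  -- extends `f`.
  obtain ⟨W, g, m, r, sq, hg, -⟩ := h.exists_pushout f
  obtain ⟨e, h1, -⟩ := Quotient.exact ((hI Z).elim ⟦⟨W, g, r, hg⟩⟧ (splitExt Z I))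
  exact ⟨m ≫ e.hom ≫ biprod.snd, by
    rw [reassoc_of% sq.w, reassoc_of% h1]
    simp⟩

/-- A conflation whose inflation has a retraction splits. -/
theorem IsConflation.exists_split {X Y Z : E} {i : X ⟶ Y} {p : Y ⟶ Z} (h : IsConflation i p)
    (r : Y ⟶ X) (hr : i ≫ r = 𝟙 X) : ∃ s : Z ⟶ Y, s ≫ p = 𝟙 Z ∧ p ≫ s = 𝟙 Y - r ≫ i ∧
      Nonempty (Y ≅ X ⊞ Z) := by
  obtain ⟨s, hs⟩ := h.desc (𝟙 Y - r ≫ i) (by simp [reassoc_of% hr])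
  have hsp : s ≫ p = 𝟙 Z := h.desc_hom (by
    rw [reassoc_of% hs, Preadditive.sub_comp, Category.assoc, h.w]; simp)
  have hsr : s ≫ r = 0 := h.desc_hom (by
    rw [reassoc_of% hs, Preadditive.sub_comp, Category.assoc, hr]; simp)
  refine ⟨s, hsp, hs, ⟨⟨biprod.lift r p, biprod.desc i s, ?_, ?_⟩⟩⟩
  · rw [biprod.lift_desc, hs]; abel
  · ext <;> simp [hr, h.w, hsp, hsr]

/-- The morphism with components `f` and an inflation `i` is an inflation. -/
theorem IsConflation.exists_biprod_lift {X I Z Y : E} {i : X ⟶ I} {p : I ⟶ Z}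
    (h : IsConflation i p) (f : X ⟶ Y) :
    ∃ (W : E) (r : Y ⊞ I ⟶ W), IsConflation (biprod.lift f i) r := by
  -- The shear `e` turns `biprod.inr` into the graph of `f`. The required morphism is this graph
  -- inclusion followed by `𝟙 Y ⊞ i`, which is an inflation as the kernel of the deflation `Y ⊞ I ↠
  -- I ↠ Z`.
  let e : Y ⊞ X ≅ Y ⊞ X :=
    { hom := biprod.lift (biprod.fst + biprod.snd ≫ f) biprod.snd
      inv := biprod.lift (biprod.fst - biprod.snd ≫ f) biprod.snd
      hom_inv_id := by ext <;> simp
      inv_hom_id := by ext <;> simp }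
  have h1 : IsConflation (biprod.inr : X ⟶ Y ⊞ X) biprod.fst := isConflation_biprod Y X
  have h2 : IsConflation (biprod.inl : Y ⟶ Y ⊞ I) biprod.snd := by
    have h := (isConflation_biprod I Y).mid (biprod.braiding I Y)
    rwa [show biprod.inr ≫ (biprod.braiding I Y).hom = biprod.inl by ext <;> simp,
      show (biprod.braiding I Y).inv ≫ biprod.fst = biprod.snd by simp] at h
  obtain ⟨K, k, hk⟩ := ExactCategory.comp_deflation (biprod.snd : Y ⊞ I ⟶ I) p ⟨_, _, h2⟩ ⟨_, _, h⟩
  replace hk : IsConflation k (biprod.snd ≫ p) := hk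
  have h3 : IsConflation (biprod.map (𝟙 Y) i) (biprod.snd ≫ p) := by
    refine hk.of_kernel _ (by simp [h.w]) (fun t ht => ?_) (fun a b hab => ?_)
    · obtain ⟨u, hu⟩ := h.lift (t ≫ biprod.snd) (by rw [Category.assoc, ht])
      exact ⟨biprod.lift (t ≫ biprod.fst) u, by ext <;> simp [hu]⟩
    · ext
      · simpa using congrArg (· ≫ biprod.fst) hab
      · exact h.lift_hom (by simpa using congrArg (· ≫ biprod.snd) hab)
  have h4 : (biprod.inr ≫ e.hom) ≫ biprod.map (𝟙 Y) i = biprod.lift f i := by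
    ext <;> simp [e]
  rw [← h4]
  exact ExactCategory.comp_inflation _ _ ⟨_, _, h1.mid e⟩ ⟨_, _, h3⟩

variable [IsFrobenius E]

/-- If `f : X ⟶ Y` is an inflation which is invertible in the stable category, then `Y ≅ X ⊞ Q` with
`Q` projective-injective. -/
theorem exists_iso_biprod_of_stable_iso {X Y Z : E} {f : X ⟶ Y} {p : Y ⟶ Z} (h : IsConflation f p)
    (g : Y ⟶ X) (h1 : stableRel E (f ≫ g) (𝟙 X)) (h2 : stableRel E (g ≫ f) (𝟙 Y)) :
    IsProjInj Z ∧ Nonempty (Y ≅ X ⊞ Z) := by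
  obtain ⟨P, hP, a, b, hab⟩ := h1
  obtain ⟨Q, hQ, c, d, hcd⟩ := h2
  -- Extending `a` along the inflation `f` lets `g` be corrected by a morphism through `P`, so that
  -- the stable retraction becomes a genuine one and the conflation splits.
  obtain ⟨a', rfl⟩ := hP.2.exists_ext h a
  obtain ⟨s, hsp, hps, e⟩ := h.exists_split (g - a' ≫ b) (by
    rw [Preadditive.comp_sub, ← Category.assoc f a' b, ← hab]; abel)
  -- On `Z` the term `g ≫ f` dies because `f ≫ p = 0`, so `g ≫ f - 𝟙 Y = c ≫ d` exhibits `Z` as a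
  -- retract of `Q`, up to the sign.
  refine ⟨(isProjInj_iff _).2 (hQ.1.of_retract (s ≫ (-c)) (d ≫ p) ?_), e⟩
  calc (s ≫ (-c)) ≫ d ≫ p = -(s ≫ (c ≫ d) ≫ p) := by simp
    _ = 𝟙 Z := by rw [← hcd]; simp [h.w, hsp]

/-- Stably isomorphic objects become isomorphic after adding projective-injective objects. -/
theorem exists_biprod_iso_of_stable_iso {X Y : E} (f : X ⟶ Y) (g : Y ⟶ X)
    (h1 : stableRel E (f ≫ g) (𝟙 X)) (h2 : stableRel E (g ≫ f) (𝟙 Y)) :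
    ∃ P Q : E, IsProjInj P ∧ IsProjInj Q ∧ Nonempty (Y ⊞ P ≅ X ⊞ Q) := by
  obtain ⟨I, _, i, _, hi, hI⟩ := IsFrobenius.enough_injectives X
  replace hI : IsProjInj I := ⟨(IsFrobenius.projective_iff_injective _).2 hI, hI⟩
  -- Adding an inflation into an injective object replaces `f` by an inflation without changing it
  -- stably, and `biprod.fst ≫ g` is still a stable inverse.
  obtain ⟨W, r, hr⟩ := hi.exists_biprod_lift f
  obtain ⟨Q, hQ, c, d, hcd⟩ := h2
  obtain ⟨hW, e⟩ := exists_iso_biprod_of_stable_iso hr (biprod.fst ≫ g)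
    (by rwa [biprod.lift_fst_assoc])
    ⟨Q ⊞ I, isProjInj_biprod hQ hI, biprod.lift (biprod.fst ≫ c) (biprod.fst ≫ g ≫ i - biprod.snd),
      biprod.desc (d ≫ biprod.inl) biprod.inr, by
        have : g ≫ f = c ≫ d + 𝟙 Y := sub_eq_iff_eq_add.1 hcd
        ext <;> simp [this]⟩
  exact ⟨I, W, hI, hW, e⟩

end Exact

/-! ### The linear map of Hall algebras is injective -/

section Map

variable {F' : Type*} [Category* F'] {F : Type*} [Category* F] {Φ : F' ⥤ F}

theorem HallAlgebra.coeff_map (x : HallAlgebra F') : HallAlgebra.coeff (HallAlgebra.map Φ x) =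
    Finsupp.mapDomain (Quotient.map (sa := isIsomorphicSetoid F') (sb := isIsomorphicSetoid F) Φ.obj
      fun _ _ ⟨e⟩ => ⟨Φ.mapIso e⟩) (HallAlgebra.coeff x) := rfl

variable [Φ.Full] [Φ.Faithful]

theorem isoClass_map_injective : Function.Injective (Quotient.map (sa := isIsomorphicSetoid F')
    (sb := isIsomorphicSetoid F) Φ.obj fun _ _ ⟨e⟩ => ⟨Φ.mapIso e⟩) := by
  intro a b
  induction a using Quotient.inductionOn with | _ A => ?_
  induction b using Quotient.inductionOn with | _ B => ?_
  intro h
  obtain ⟨e⟩ := isoClass_eq.1 h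
  exact isoClass_eq.2 ⟨Φ.preimageIso e⟩

theorem HallAlgebra.map_injective : Function.Injective (HallAlgebra.map Φ) := fun x y h => by
  have := congrArg HallAlgebra.coeff h
  rw [coeff_map, coeff_map] at this
  exact coeff.injective (Finsupp.mapDomain_injective isoClass_map_injective this)

end Map

/-! ### The homomorphism of Hall algebras -/

section Functoriality

variable {F' : Type*} [Category* F'] [Preadditive F'] [HasZeroObject F'] [HasBinaryBiproducts F']
  [ExactCategory F'] [IsFrobenius F']
  {F : Type*} [Category* F] [Preadditive F] [HasZeroObject F] [HasBinaryBiproducts F]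
  [ExactCategory F]
  {Φ : F' ⥤ F}

namespace IsFrobeniusMap

section

variable [Φ.Full]

/-- A full map of Frobenius categories is essentially surjective on the conflations with given end
terms. -/
theorem exists_conflation_lift (hΦ : IsFrobeniusMap Φ) {A C : F'} {M : F} {j : Φ.obj C ⟶ M}
    {q : M ⟶ Φ.obj A} (h : IsConflation j q) : ∃ (B : F') (i : C ⟶ B) (p : B ⟶ A)
      (e : Φ.obj B ≅ M), IsConflation i p ∧ Φ.map i ≫ e.hom = j ∧ e.hom ≫ q = Φ.map p := by
  obtain ⟨K, P, k, s, hk, hP⟩ := IsFrobenius.enough_projectives A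
  replace hP := hΦ.map_projInj ((isProjInj_iff _).2 hP)
  have hk' := hΦ.map_conflation hk
  -- Projectivity of `Φ P` presents the given conflation as a pushout of the image of `K ↣ P ↠ A`;
  -- by fullness the morphism pushed along comes from `F'`.
  obtain ⟨l, hl⟩ := hP.1.exists_lift h (Φ.map s)
  obtain ⟨f, hf⟩ := h.lift (Φ.map k ≫ l) (by rw [Category.assoc, hl, hk'.w])
  obtain ⟨f, rfl⟩ := Φ.map_surjective f
  obtain ⟨W, g, m, r, sq, hg, hmr⟩ := hk.exists_pushout f
  -- The pushout formed in `F` is compared with both `Φ W` and `M` by the five lemma, so `Φ` need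
  -- not be known to preserve pushouts.
  obtain ⟨W', g', m', r', sq', hg', hmr'⟩ := hk'.exists_pushout (Φ.map f)
  obtain ⟨e, he, her⟩ := hg'.exists_iso_of_pushout sq' (hΦ.map_conflation hg) (Φ.map m)
    (by rw [← Φ.map_comp, hmr, hmr']) (by rw [← Φ.map_comp, sq.w, Φ.map_comp])
  obtain ⟨e', he', her'⟩ := hg'.exists_iso_of_pushout sq' h l (by rw [hl, hmr']) hf.symm
  exact ⟨W, g, r, e.symm ≪≫ e', hg, by simp [← he, he'], by simp [her', ← her]⟩

variable [Φ.Faithful]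

/-- Lifting the image conflation gives a conflation of `F'` with the same end terms; full
faithfulness pulls the isomorphism of middle terms back to `F'`. -/
theorem isConflation_of_map (hΦ : IsFrobeniusMap Φ) {X Y Z : F'} {i : X ⟶ Y} {p : Y ⟶ Z}
    (h : IsConflation (Φ.map i) (Φ.map p)) : IsConflation i p := by
  obtain ⟨B, i', p', e, hB, h1, h2⟩ := hΦ.exists_conflation_lift h
  have h1' : i' ≫ (Φ.preimageIso e).hom = i := Φ.map_injective (by simpa using h1)
  have h2' : (Φ.preimageIso e).inv ≫ p' = p := by
    rw [Iso.inv_comp_eq]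
    exact Φ.map_injective (by simpa using h2.symm)
  rw [← h1', ← h2']
  exact hB.mid (Φ.preimageIso e)

variable [HomFinite F'] [HomFinite F]

/-- In the form of `structureConst_eq` the constant counts conflations with fixed terms and
automorphisms. Both counts are invariant, since `Φ` is bijective on morphisms and preserves and
reflects conflations. -/
theorem structureConst_map (hΦ : IsFrobeniusMap Φ) (A B C : F') :
    structureConst (Φ.obj A) (Φ.obj C) (isoClass (Φ.obj B)) = structureConst A C (isoClass B) := by
  rw [structureConst_eq, structureConst_eq]
  have hΦf : Φ.FullyFaithful := Functor.FullyFaithful.ofFullyFaithful Φ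
  congr 2
  · exact (Nat.card_congr (Equiv.subtypeEquiv (hΦf.homEquiv.prodCongr hΦf.homEquiv)
      fun t => ⟨hΦ.map_conflation, hΦ.isConflation_of_map⟩)).symm
  · exact (Nat.card_congr hΦf.isoEquiv).symm

end

end IsFrobeniusMap

variable [Φ.Full] [Φ.Faithful]

variable [HomFinite F'] [HomFinite F] [IsFrobenius F]

namespace IsFrobeniusMap

/-- On classes in the image the coefficients agree by `structureConst_map`. On other classes both
sides vanish, because a middle term of a conflation with ends in the image is itself in the image up
to isomorphism. -/
theorem map_of_mul_of (hΦ : IsFrobeniusMap Φ) (A C : F') :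
    HallAlgebra.map Φ (HallAlgebra.of A * HallAlgebra.of C) =
      HallAlgebra.of (Φ.obj A) * HallAlgebra.of (Φ.obj C) := by
  refine HallAlgebra.ext_coeff fun b => ?_
  rw [HallAlgebra.coeff_of_mul_of, HallAlgebra.coeff_map]
  by_cases hb : ∃ B : F', isoClass (Φ.obj B) = b
  · obtain ⟨B, rfl⟩ := hb
    rw [hΦ.structureConst_map, ← HallAlgebra.coeff_of_mul_of]
    exact Finsupp.mapDomain_apply isoClass_map_injective _ (isoClass B)
  · rw [Finsupp.mapDomain_of_notMem_range]
    · induction b using Quotient.inductionOn with | _ M => ?_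
      by_contra h
      obtain ⟨t⟩ := (structureConst_ne_zero_iff _ _ M).1 (Ne.symm h)
      obtain ⟨B, _, _, e, -⟩ := hΦ.exists_conflation_lift t.2
      exact hb ⟨B, isoClass_eq.2 ⟨e⟩⟩
    · rintro ⟨a, rfl⟩
      induction a using Quotient.inductionOn with | _ A => ?_
      exact hb ⟨A, rfl⟩

/-- A fully faithful map of Frobenius categories induces a homomorphism of Hall algebras. -/
noncomputable def hallHom (hΦ : IsFrobeniusMap Φ) : HallAlgebra F' →+* HallAlgebra F where
  toFun := HallAlgebra.map Φ
  map_zero' := map_zero _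
  map_add' := map_add _
  map_one' := by
    have := hΦ.additive
    rw [HallAlgebra.one_def, HallAlgebra.map_of, HallAlgebra.of_congr Φ.mapZeroObject,
      HallAlgebra.one_def]
  map_mul' x y := by
    induction x using HallAlgebra.induction with
    | h0 => simp
    | hadd x x' hx hx' => simp only [add_mul, map_add, hx, hx']
    | hsmul r A =>
      induction y using HallAlgebra.induction with
      | h0 => simp
      | hadd y y' hy hy' => simp only [mul_add, map_add, hy, hy']
      | hsmul s C =>
        simp only [smul_mul_assoc, mul_smul_comm, map_smul, hΦ.map_of_mul_of, HallAlgebra.map_of]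

theorem hallHom_apply (hΦ : IsFrobeniusMap Φ) (x : HallAlgebra F') :
    hΦ.hallHom x = HallAlgebra.map Φ x := rfl

theorem hallHom_mem_projClasses (hΦ : IsFrobeniusMap Φ) {s : HallAlgebra F'}
    (hs : s ∈ projClasses F') : hΦ.hallHom s ∈ projClasses F := by
  induction hs using Submonoid.closure_induction with
  | mem s hs =>
    obtain ⟨P, hP, rfl⟩ := hs
    rw [hallHom_apply, HallAlgebra.map_of]
    exact Submonoid.subset_closure ⟨_, hΦ.map_projInj hP, rfl⟩
  | one => rw [map_one]; exact one_mem _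
  | mul s t _ _ hs ht => rw [map_mul]; exact mul_mem hs ht

end IsFrobeniusMap

end Functoriality

/-! ### The Hall algebra embeds in its localization -/

section Localization

variable {F : Type u} [Category.{v} F] [Preadditive F] [HasZeroObject F] [HasBinaryBiproducts F]
  [ExactCategory F] [IsFrobenius F] [HomFinite F]

/-- The product `[P] ⋄ [C]` is a multiple of `[P ⊞ C]`, and by cancellation only `C ≅ B` contributes
to the class of `P ⊞ B`. Every coefficient of `x` can thus be read off from `[P] ⋄ x`. -/
theorem coeff_proj_mul_biprod [IsIdempotentComplete F] {P : F} (hP : IsProjInj P)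
    (x : HallAlgebra F) (B : F) :
    HallAlgebra.coeff (HallAlgebra.of P * x) (isoClass (P ⊞ B)) =
      (Nat.card (P ⟶ B) : ℚ)⁻¹ * HallAlgebra.coeff x (isoClass B) := by
  classical
  induction x using HallAlgebra.induction with
  | h0 => simp
  | hadd x y hx hy => simp only [mul_add, map_add, Finsupp.add_apply, hx, hy]
  | hsmul r C =>
    rw [mul_smul_comm, of_proj_mul hP]
    simp only [HallAlgebra.of, map_smul, Finsupp.smul_apply, HallAlgebra.coeff_basis,
      Finsupp.single_apply]
    by_cases h : isoClass C = isoClass B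
    · obtain ⟨e⟩ := isoClass_eq.1 h
      have h1 : Nat.card (P ⟶ C) = Nat.card (P ⟶ B) :=
        Nat.card_congr ((Iso.refl P).homCongr e)
      rw [if_pos h, if_pos (isoClass_eq.2 (nonempty_iso_biprod_congr ⟨Iso.refl P⟩ ⟨e⟩)), h1]
      simp only [smul_eq_mul]
      ring
    · rw [if_neg h, if_neg fun h' => h (isoClass_eq.2 ((isoClass_eq.1 h').elim
        nonempty_iso_of_biprod_iso))]
      simp

theorem projClasses_le_nonZeroDivisorsLeft [IsIdempotentComplete F] :
    projClasses F ≤ nonZeroDivisorsLeft (HallAlgebra F) := by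
  rw [projClasses, Submonoid.closure_le]
  rintro _ ⟨P, hP, rfl⟩ x hx
  refine HallAlgebra.ext_coeff fun b => ?_
  induction b using Quotient.inductionOn with | _ B => ?_
  have := coeff_proj_mul_biprod hP x B
  rw [hx] at this
  simpa [card_hom_ne_zero P B] using this.symm

variable (F) in
/-- The localization map, as a homomorphism of algebras. -/
noncomputable def toSDHAlgHom : HallAlgebra F →ₐ[ℚ] SemiDerivedHallAlgebra F :=
  RingHom.toRatAlgHom
    { toSDH F with
      map_zero' := OreLocalization.zero_oreDiv _
      map_add' := fun _ _ => OreLocalization.add_oreDiv.symm }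

theorem toSDHAlgHom_injective [IsIdempotentComplete F] : Function.Injective (toSDHAlgHom F) :=
  OreLocalization.numeratorHom_inj projClasses_le_nonZeroDivisorsLeft

end Localization

/-! ### `K₀` and the group completion of the monoid of isomorphism classes -/

section Grothendieck

section

variable {E : Type u} [Category.{v} E] [Preadditive E] [HasBinaryBiproducts E]

noncomputable instance : Add (IsoClass E) :=
  ⟨Quotient.map₂ (sa := isIsomorphicSetoid E) (sb := isIsomorphicSetoid E)
    (sc := isIsomorphicSetoid E) (fun A B => A ⊞ B) fun _ _ h _ _ h' =>
      nonempty_iso_biprod_congr h h'⟩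

theorem isoClass_biprod (A B : E) : isoClass (A ⊞ B) = isoClass A + isoClass B := rfl

variable [HasZeroObject E]

noncomputable instance : Zero (IsoClass E) := ⟨isoClass 0⟩

/-- The commutative monoid of isomorphism classes of objects under direct sums. -/
noncomputable instance : AddCommMonoid (IsoClass E) where
  nsmul := nsmulRec
  add_assoc a b c := by
    induction a, b, c using Quotient.inductionOn₃ with | _ A B C => ?_
    refine isoClass_eq.2 ⟨⟨biprod.lift (biprod.fst ≫ biprod.fst)
      (biprod.lift (biprod.fst ≫ biprod.snd) biprod.snd),
      biprod.lift (biprod.lift biprod.fst (biprod.snd ≫ biprod.fst)) (biprod.snd ≫ biprod.snd),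
      ?_, ?_⟩⟩ <;> ext <;> simp
  zero_add a := by
    induction a using Quotient.inductionOn with | _ A => ?_
    exact isoClass_eq.2 ⟨⟨biprod.snd, biprod.inr, by ext; simp, by simp⟩⟩
  add_zero a := by
    induction a using Quotient.inductionOn with | _ A => ?_
    exact isoClass_eq.2 ⟨⟨biprod.fst, biprod.inl, by ext; simp, by simp⟩⟩
  add_comm a b := by
    induction a, b using Quotient.inductionOn₂ with | _ A B => ?_
    exact isoClass_eq.2 ⟨biprod.braiding A B⟩

/-- Cancellation makes the map from this monoid to its group completion injective, so equalities
there give isomorphisms of objects. -/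
instance [HomFinite E] [IsIdempotentComplete E] : IsCancelAdd (IsoClass E) :=
  have : IsLeftCancelAdd (IsoClass E) := ⟨fun a b c h => by
    induction a, b, c using Quotient.inductionOn₃ with | _ A B C => ?_
    exact isoClass_eq.2 ((isoClass_eq.1 h).elim nonempty_iso_of_biprod_iso)⟩
  AddCommMagma.IsLeftCancelAdd.toIsCancelAdd _

end

variable {F : Type u} [Category.{v} F] [Preadditive F] [HasZeroObject F] [HasBinaryBiproducts F]
  [ExactCategory F]

variable (F) in
/-- The class of a projective-injective object in the group completion of the monoid of isomorphism
classes. -/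
noncomputable def k0ToGrothendieck :
    K0ProjInj F →+ Algebra.GrothendieckAddGroup (IsoClass F) :=
  QuotientAddGroup.lift _ (FreeAbelianGroup.lift fun P =>
    Algebra.GrothendieckAddGroup.of (isoClass P.obj)) <| by
  rw [K0Relations, AddSubgroup.closure_le]
  rintro _ ⟨X, Y, Z, i, p, h, rfl⟩
  -- The first term is injective, so the conflation splits and the `K₀` relation becomes additivity
  -- on direct sums.
  obtain ⟨r, hr⟩ := X.property.2.exists_ext h (𝟙 _)
  obtain ⟨-, -, -, e⟩ := h.exists_split r hr
  rw [SetLike.mem_coe, AddMonoidHom.mem_ker, map_sub, map_sub, FreeAbelianGroup.lift_apply_of,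
    FreeAbelianGroup.lift_apply_of, FreeAbelianGroup.lift_apply_of, isoClass_eq.2 e,
    isoClass_biprod, map_add]
  abel

theorem k0ToGrothendieck_of (P : ObjectProperty.FullSubcategory (IsProjInj (F := F))) :
    k0ToGrothendieck F (QuotientAddGroup.mk (FreeAbelianGroup.of P)) =
      Algebra.GrothendieckAddGroup.of (isoClass P.obj) :=
  FreeAbelianGroup.lift_apply_of _ _

end Grothendieck

/-! ### Objects of `F` in terms of objects in the image -/

namespace IsFrobeniusMap

variable {F' : Type*} [Category* F'] [Preadditive F'] [HasZeroObject F'] [HasBinaryBiproducts F']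
  [ExactCategory F']
  {F : Type*} [Category* F] [Preadditive F] [HasZeroObject F] [HasBinaryBiproducts F]
  [ExactCategory F] {Φ : F' ⥤ F}

theorem mapK0_of (hΦ : IsFrobeniusMap Φ)
    (P : ObjectProperty.FullSubcategory (IsProjInj (F := F'))) :
    hΦ.mapK0 (QuotientAddGroup.mk (FreeAbelianGroup.of P)) =
      QuotientAddGroup.mk (FreeAbelianGroup.of ⟨Φ.obj P.obj, hΦ.map_projInj P.property⟩) :=
  congrArg _ (FreeAbelianGroup.map_of_apply _)

/-- If the stable functor is essentially surjective, then every object is stably isomorphic to an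
object in the image. -/
theorem exists_biprod_iso_of_stable [IsFrobenius F] (hΦ : IsFrobeniusMap Φ)
    (hstable : hΦ.stableFunctor.EssSurj) (M : F) : ∃ (N : F') (P Q : F), IsProjInj P ∧
      IsProjInj Q ∧ Nonempty (P ⊞ M ≅ Q ⊞ Φ.obj N) := by
  obtain ⟨N, ⟨e⟩⟩ := hstable.mem_essImage ((CategoryTheory.Quotient.functor (stableRel F)).obj M)
  let e' : (CategoryTheory.Quotient.functor (stableRel F)).obj (Φ.obj N.as) ≅
    (CategoryTheory.Quotient.functor (stableRel F)).obj M := e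
  obtain ⟨f, hf⟩ := (CategoryTheory.Quotient.functor (stableRel F)).map_surjective e'.hom
  obtain ⟨g, hg⟩ := (CategoryTheory.Quotient.functor (stableRel F)).map_surjective e'.inv
  obtain ⟨P, Q, hP, hQ, ⟨d⟩⟩ := exists_biprod_iso_of_stable_iso f g
    ((CategoryTheory.Quotient.functor_map_eq_iff _ _ _).1 (by
      rw [Functor.map_comp, hf, hg, Iso.hom_inv_id, CategoryTheory.Functor.map_id]))
    ((CategoryTheory.Quotient.functor_map_eq_iff _ _ _).1 (by
      rw [Functor.map_comp, hf, hg, Iso.inv_hom_id, CategoryTheory.Functor.map_id]))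
  exact ⟨N.as, P, Q, hP, hQ, ⟨biprod.braiding _ _ ≪≫ d ≪≫ biprod.braiding _ _⟩⟩

variable [IsFrobenius F']

/-- If the map on Grothendieck groups is surjective, then projective-injective objects are formal
differences of objects in the image, up to isomorphism. -/
theorem exists_biprod_iso_of_mapK0_surjective [HomFinite F] [IsIdempotentComplete F]
    (hΦ : IsFrobeniusMap Φ) (hK0 : Function.Surjective hΦ.mapK0) {Q : F} (hQ : IsProjInj Q) :
    ∃ P P' : F', IsProjInj P ∧ IsProjInj P' ∧ Nonempty (Q ⊞ Φ.obj P ≅ Φ.obj P') := by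
  have := hΦ.additive
  have := preservesBinaryBiproducts_of_preservesBiproducts Φ
  -- The values of `δ` are formal differences of classes `Φ P`, a property closed under sums and
  -- negatives, hence checked on generators of the free group.
  let δ := ((k0ToGrothendieck F).comp hΦ.mapK0).comp (QuotientAddGroup.mk' _)
  have hof : ∀ P, δ (FreeAbelianGroup.of P) =
      Algebra.GrothendieckAddGroup.of (isoClass (Φ.obj P.obj)) := fun P =>
    (congrArg (k0ToGrothendieck F) (hΦ.mapK0_of P)).trans (k0ToGrothendieck_of _)
  have hδ : ∀ z, ∃ P P' : F', IsProjInj P ∧ IsProjInj P' ∧ δ z +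
      Algebra.GrothendieckAddGroup.of (isoClass (Φ.obj P)) =
        Algebra.GrothendieckAddGroup.of (isoClass (Φ.obj P')) := fun z => by
    have h0 : Algebra.GrothendieckAddGroup.of (isoClass (Φ.obj 0)) = 0 :=
      (congrArg _ (isoClass_eq.2 ⟨Φ.mapZeroObject⟩)).trans (map_zero _)
    have hbi : ∀ P P' : F', isoClass (Φ.obj (P ⊞ P')) =
        isoClass (Φ.obj P) + isoClass (Φ.obj P') := fun P P' =>
      (isoClass_eq.2 ⟨Φ.mapBiprod P P'⟩).trans (isoClass_biprod _ _)
    induction z using FreeAbelianGroup.induction_on with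
    | zero => exact ⟨0, 0, isProjInj_zero, isProjInj_zero, by simp⟩
    | of P =>
      refine ⟨0, P.obj, isProjInj_zero, P.property, ?_⟩
      rw [hof, h0, add_zero]
    | neg P _ =>
      refine ⟨P.obj, 0, P.property, isProjInj_zero, ?_⟩
      rw [h0, map_neg, hof, neg_add_cancel]
    | add x y hx hy =>
      obtain ⟨P, P', hP, hP', h⟩ := hx
      obtain ⟨Q, Q', hQ, hQ', h'⟩ := hy
      refine ⟨P ⊞ Q, P' ⊞ Q', isProjInj_biprod hP hQ, isProjInj_biprod hP' hQ', ?_⟩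
      rw [hbi, hbi, map_add, map_add, map_add, ← h, ← h']
      abel
  obtain ⟨z, hz⟩ := hK0 (QuotientAddGroup.mk (FreeAbelianGroup.of ⟨Q, hQ⟩))
  obtain ⟨z, rfl⟩ := QuotientAddGroup.mk_surjective z
  obtain ⟨P, P', hP, hP', h⟩ := hδ z
  refine ⟨P, P', hP, hP', isoClass_eq.1 (Algebra.GrothendieckAddGroup.of_injective ?_)⟩
  have hδz : δ z = Algebra.GrothendieckAddGroup.of (isoClass Q) :=
    (congrArg (k0ToGrothendieck F) hz).trans (k0ToGrothendieck_of _)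
  rw [isoClass_biprod, map_add, ← h, hδz]

end IsFrobeniusMap

/-! ### Fractions in the semi-derived Hall algebra -/

section Localization

variable {F : Type u} [Category.{v} F] [Preadditive F] [HasZeroObject F] [HasBinaryBiproducts F]
  [ExactCategory F] [IsFrobenius F] [HomFinite F]

theorem toSDHAlgHom_of_congr {A B : F} (h : Nonempty (A ≅ B)) :
    toSDHAlgHom F (HallAlgebra.of A) = toSDHAlgHom F (HallAlgebra.of B) :=
  h.elim fun e => congrArg _ (HallAlgebra.of_congr e)

/-- There are no nonsplit extensions of `P`, so the product is a single term. This is what turns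
isomorphisms of direct sums into equations that can be solved for a factor. -/
theorem toSDHAlgHom_of_biprod {P : F} (hP : IsProjInj P) (C : F) :
    toSDHAlgHom F (HallAlgebra.of (P ⊞ C)) = (Nat.card (P ⟶ C) : ℚ) •
      (toSDHAlgHom F (HallAlgebra.of P) * toSDHAlgHom F (HallAlgebra.of C)) := by
  rw [← map_mul, of_proj_mul hP, map_smul, smul_smul, mul_inv_cancel₀ (card_hom_ne_zero P C),
    one_smul]

theorem isUnit_toSDHAlgHom {s : HallAlgebra F} (hs : s ∈ projClasses F) :
    IsUnit (toSDHAlgHom F s) := OreLocalization.numerator_isUnit ⟨s, hs⟩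

theorem isUnit_toSDHAlgHom_of {P : F} (hP : IsProjInj P) :
    IsUnit (toSDHAlgHom F (HallAlgebra.of P)) :=
  isUnit_toSDHAlgHom (Submonoid.subset_closure ⟨P, hP, rfl⟩)

/-- Denominators clear on the left. Since the image of `s` is a unit, statements about fractions
reduce to statements about the Hall algebra. -/
theorem exists_mul_eq_toSDHAlgHom (x : SemiDerivedHallAlgebra F) : ∃ s ∈ projClasses F, ∃ y,
    toSDHAlgHom F s * x = toSDHAlgHom F y := by
  induction x using OreLocalization.ind with | _ r s => ?_
  refine ⟨s, s.2, r, ?_⟩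
  change (s : HallAlgebra F) /ₒ (1 : projClasses F) * (r /ₒ s) = r /ₒ 1
  exact OreLocalization.mul_cancel

end Localization

/-- A subalgebra which contains the inverses of the classes of the projective-injective objects and
the classes of all objects is everything. -/
theorem eq_top_of_forall_of_mem {F : Type u} [Category.{v} F] [Preadditive F] [HasZeroObject F]
    [HasBinaryBiproducts F] [ExactCategory F] [IsFrobenius F] [HomFinite F]
    (T : Subalgebra ℚ (SemiDerivedHallAlgebra F))
    (hof : ∀ M : F, toSDHAlgHom F (HallAlgebra.of M) ∈ T)
    (hinv : ∀ P : F, IsProjInj P → ∃ t ∈ T, t * toSDHAlgHom F (HallAlgebra.of P) = 1) : T = ⊤ := by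
  have h1 : ∀ y, toSDHAlgHom F y ∈ T := fun y => by
    induction y using HallAlgebra.induction with
    | h0 => rw [map_zero]; exact zero_mem _
    | hadd x y hx hy => rw [map_add]; exact add_mem hx hy
    | hsmul r X => rw [map_smul]; exact T.smul_mem (hof X) r
  have h2 : ∀ s ∈ projClasses F, ∃ t ∈ T, t * toSDHAlgHom F s = 1 := fun s hs => by
    induction hs using Submonoid.closure_induction with
    | mem s hs =>
      obtain ⟨P, hP, rfl⟩ := hs
      exact hinv P hP
    | one => exact ⟨1, one_mem _, by rw [map_one, one_mul]⟩
    | mul s s' _ _ hs hs' =>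
      obtain ⟨t, ht, h⟩ := hs
      obtain ⟨t', ht', h'⟩ := hs'
      exact ⟨t' * t, mul_mem ht' ht, by
        rw [map_mul, mul_assoc, ← mul_assoc t, h, one_mul, h']⟩
  refine eq_top_iff.2 fun x _ => ?_
  obtain ⟨s, hs, y, hy⟩ := exists_mul_eq_toSDHAlgHom x
  obtain ⟨t, ht, h⟩ := h2 s hs
  rw [← one_mul x, ← h, mul_assoc, hy]
  exact mul_mem ht (h1 y)

/-! ### The induced homomorphism is bijective -/

namespace IsFrobeniusMap

variable {F' : Type*} [Category* F'] [Preadditive F'] [HasZeroObject F'] [HasBinaryBiproducts F']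
  [ExactCategory F'] [IsFrobenius F'] [HomFinite F']
  {F : Type*} [Category* F] [Preadditive F] [HasZeroObject F] [HasBinaryBiproducts F]
  [ExactCategory F] [IsFrobenius F] [HomFinite F]
  {Φ : F' ⥤ F} [Φ.Full] [Φ.Faithful]

/-- The homomorphism of semi-derived Hall algebras induced by a fully faithful map of Frobenius
categories. -/
noncomputable def sdhHom (hΦ : IsFrobeniusMap Φ) :
    SemiDerivedHallAlgebra F' →ₐ[ℚ] SemiDerivedHallAlgebra F :=
  RingHom.toRatAlgHom <| OreLocalization.universalHom
    ((toSDHAlgHom F).toRingHom.comp hΦ.hallHom)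
    (IsUnit.liftRight (((toSDHAlgHom F).toRingHom.comp hΦ.hallHom).toMonoidHom.comp
      (projClasses F').subtype) fun s => isUnit_toSDHAlgHom (hΦ.hallHom_mem_projClasses s.2))
    fun _ => rfl

theorem sdhHom_toSDH (hΦ : IsFrobeniusMap Φ) (x : HallAlgebra F') :
    hΦ.sdhHom (toSDHAlgHom F' x) = toSDHAlgHom F (HallAlgebra.map Φ x) :=
  OreLocalization.universalHom_commutes _ _ _

theorem sdhHom_of (hΦ : IsFrobeniusMap Φ) (M : F') : hΦ.sdhHom (toSDHAlgHom F' (HallAlgebra.of M)) =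
    toSDHAlgHom F (HallAlgebra.of (Φ.obj M)) := by
  rw [sdhHom_toSDH, HallAlgebra.map_of]

/-- After a denominator is cleared, a kernel element is represented by some `y` in the Hall algebra
of `F'`. Both the Hall map and the localization map of `F` are injective, so `y = 0`. -/
theorem sdhHom_injective [IsIdempotentComplete F] (hΦ : IsFrobeniusMap Φ) :
    Function.Injective hΦ.sdhHom := by
  rw [injective_iff_map_eq_zero]
  intro x hx
  obtain ⟨s, hs, y, hy⟩ := exists_mul_eq_toSDHAlgHom x
  have h : toSDHAlgHom F (HallAlgebra.map Φ y) = 0 := by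
    rw [← hΦ.sdhHom_toSDH, ← hy, map_mul, hx, mul_zero]
  rw [map_eq_zero_iff _ toSDHAlgHom_injective, map_eq_zero_iff _ HallAlgebra.map_injective] at h
  rw [h, map_zero] at hy
  exact (isUnit_toSDHAlgHom hs).mul_right_eq_zero.1 hy

/-- The inverse of the class of a projective-injective object in the image is in the image. -/
theorem exists_sdhHom_mul_eq_one (hΦ : IsFrobeniusMap Φ) {P : F'} (hP : IsProjInj P) :
    ∃ t ∈ hΦ.sdhHom.range, toSDHAlgHom F (HallAlgebra.of (Φ.obj P)) * t = 1 ∧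
      t * toSDHAlgHom F (HallAlgebra.of (Φ.obj P)) = 1 := by
  obtain ⟨u, hu⟩ := isUnit_toSDHAlgHom_of hP
  refine ⟨hΦ.sdhHom ↑u⁻¹, ⟨_, rfl⟩, ?_, ?_⟩
  · rw [← hΦ.sdhHom_of, ← hu, ← map_mul, Units.mul_inv, map_one]
  · rw [← hΦ.sdhHom_of, ← hu, ← map_mul, Units.inv_mul, map_one]

/-- The image is a subalgebra, so by `eq_top_of_forall_of_mem` it suffices to find all `[M]` and all
inverses `[Q]⁻¹` in it. -/
theorem sdhHom_surjective [IsIdempotentComplete F] (hΦ : IsFrobeniusMap Φ)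
    (hstable : hΦ.stableFunctor.EssSurj) (hK0 : Function.Surjective hΦ.mapK0) :
    Function.Surjective hΦ.sdhHom := by
  have hΦof : ∀ M : F', toSDHAlgHom F (HallAlgebra.of (Φ.obj M)) ∈ hΦ.sdhHom.range :=
    fun M => ⟨_, hΦ.sdhHom_of M⟩
  have hproj : ∀ Q : F, IsProjInj Q → toSDHAlgHom F (HallAlgebra.of Q) ∈ hΦ.sdhHom.range ∧
      ∃ t ∈ hΦ.sdhHom.range, t * toSDHAlgHom F (HallAlgebra.of Q) = 1 := fun Q hQ => by
    obtain ⟨P, P', hP, hP', e⟩ := hΦ.exists_biprod_iso_of_mapK0_surjective hK0 hQ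
    obtain ⟨t, ht, h1, -⟩ := hΦ.exists_sdhHom_mul_eq_one hP
    obtain ⟨t', ht', -, h2⟩ := hΦ.exists_sdhHom_mul_eq_one hP'
    have h := toSDHAlgHom_of_congr e
    rw [toSDHAlgHom_of_biprod hQ] at h
    have hc := card_hom_ne_zero Q (Φ.obj P)
    set c : ℚ := (Nat.card (Q ⟶ Φ.obj P) : ℚ)
    -- The isomorphism `Q ⊞ Φ P ≅ Φ P'` reads `c • ([Q] ⋄ [Φ P]) = [Φ P']`. Solving gives `[Q] = c⁻¹
    -- • ([Φ P'] ⋄ t)`, whose inverse is `c • ([Φ P] ⋄ t')`, where `t` and `t'` invert `[Φ P]` and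
    -- `[Φ P']`.
    have hQT : toSDHAlgHom F (HallAlgebra.of Q) =
        c⁻¹ • (toSDHAlgHom F (HallAlgebra.of (Φ.obj P')) * t) := by
      rw [← h, smul_mul_assoc, mul_assoc, h1, mul_one, smul_smul, inv_mul_cancel₀ hc, one_smul]
    refine ⟨?_, c • (toSDHAlgHom F (HallAlgebra.of (Φ.obj P)) * t'),
      Subalgebra.smul_mem _ (mul_mem (hΦof P) ht') c, ?_⟩
    · rw [hQT]
      exact Subalgebra.smul_mem _ (mul_mem (hΦof P') ht) _
    · rw [hQT, smul_mul_assoc, mul_smul_comm, smul_smul, mul_inv_cancel₀ hc, one_smul, mul_assoc,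
        ← mul_assoc t', h2, one_mul, h1]
  rw [← AlgHom.range_eq_top]
  refine eq_top_of_forall_of_mem _ (fun M => ?_) fun P hP => (hproj P hP).2
  -- Likewise `P ⊞ M ≅ Q ⊞ Φ N` is solved for `[M]`, now that `[P]⁻¹` and `[Q]` are known to lie in
  -- the image.
  obtain ⟨N, P, Q, hP, hQ, e⟩ := hΦ.exists_biprod_iso_of_stable hstable M
  obtain ⟨t, ht, h1⟩ := (hproj P hP).2
  have h := toSDHAlgHom_of_congr e
  rw [toSDHAlgHom_of_biprod hP, toSDHAlgHom_of_biprod hQ] at h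
  have hM : toSDHAlgHom F (HallAlgebra.of M) = (Nat.card (P ⟶ M) : ℚ)⁻¹ • (t *
      ((Nat.card (Q ⟶ Φ.obj N) : ℚ) • (toSDHAlgHom F (HallAlgebra.of Q) *
        toSDHAlgHom F (HallAlgebra.of (Φ.obj N))))) := by
    rw [← h, mul_smul_comm, smul_smul, inv_mul_cancel₀ (card_hom_ne_zero P M), one_smul,
      ← mul_assoc, h1, one_mul]
  rw [hM]
  exact Subalgebra.smul_mem _ (mul_mem ht (Subalgebra.smul_mem _
    (mul_mem (hproj Q hQ).1 (hΦof N)) _)) _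

end IsFrobeniusMap

end SemiDerivedHall

/-! ### The isomorphism and its uniqueness -/

open SemiDerivedHall in
theorem mainTheorem3
    {k' : Type*} [Field k'] {F' : Type*} [Category* F'] [Preadditive F'] [HasZeroObject F']
    [HasBinaryBiproducts F'] [ExactCategory F'] [IsFrobenius F']
    [EssentiallySmall.{w'} F'] [IsIdempotentComplete F'] [Linear k' F'] [HomFinite F']
    {k : Type*} [Field k] {F : Type*} [Category* F] [Preadditive F] [HasZeroObject F]
    [HasBinaryBiproducts F] [ExactCategory F] [IsFrobenius F]
    [EssentiallySmall.{w} F] [IsIdempotentComplete F] [Linear k F] [HomFinite F]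
    (Φ : F' ⥤ F) [Φ.Full] [Φ.Faithful] (hΦ : IsFrobeniusMap Φ)
    (hstable : hΦ.stableFunctor.IsEquivalence)
    (hK0 : Function.Bijective hΦ.mapK0) :
    ∃! φ : SemiDerivedHallAlgebra F' ≃ₐ[ℚ] SemiDerivedHallAlgebra F,
      ∀ x : HallAlgebra F', φ (toSDH F' x) = toSDH F (HallAlgebra.map Φ x) := by
  -- The condition ranges over the whole Hall algebra, which by `ℚ`-linearity amounts to prescribing
  -- the images of the classes `[M]`.
  refine ⟨AlgEquiv.ofBijective hΦ.sdhHom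
    ⟨hΦ.sdhHom_injective, hΦ.sdhHom_surjective hstable.essSurj hK0.2⟩, hΦ.sdhHom_toSDH,
    fun ψ hψ => AlgEquiv.ext fun x => ?_⟩
  -- Uniqueness: after multiplication by the unit `[s]`, both isomorphisms are evaluated on elements
  -- of the Hall algebra, where they agree.
  obtain ⟨s, hs, y, hy⟩ := exists_mul_eq_toSDHAlgHom x
  have h : ∀ z, ψ (toSDHAlgHom F' z) = hΦ.sdhHom (toSDHAlgHom F' z) := fun z =>
    (hψ z).trans (hΦ.sdhHom_toSDH z).symm
  refine ((isUnit_toSDHAlgHom hs).map ψ).mul_right_inj.1 ?_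
  change _ = _ * hΦ.sdhHom x
  rw [← map_mul, hy, h, h, ← map_mul, hy]
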